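/- Let $1<p\le 2\le q<\infty$. There is a constant $C<\infty$, depending only on $p$ and $q$, such that the following holds. Let $G$ be a compact Lie group with Haar probability measure, and let $A$ be a left Fourier multiplier on $G$, i.e. a closed, densely defined, possibly unbounded operator on $L^2(G)$ that commutes with all left translations $f\mapsto f(g^{-1}\,\cdot\,)$, $g\in G$. Let $\widehat G$ be the set of equivalence classes of continuous irreducible unitary representations of $G$ (with one unitary matrix representative $\xi$ fixed in each class), let $d_\xi$ be the dimension of the representation space $\mathcal H_\xi\simeq\mathbb C^{d_\xi}$, and let $\sigma_A(\xi)=\xi(x)^*(A\xi)(x)\in\mathbb C^{d_\xi\times d_\xi}$ be the global matrix symbol of $A$, where $A$ acts on $\xi$ entrywise and the right-hand side does not depend on $x\in G$. Then $$\|A\|_{L^p(G)\to L^q(G)}\le C\,\sup_{s\ge 0}\, s\Big(\sum_{\xi\in\widehat G:\ \|\sigma_A(\xi)\|_{\mathcal L(\mathcal H_\xi)}\ge s} d_\xi^2\Big)^{\frac1p-\frac1q},$$ where $\|A\|_{L^p(G)\to L^q(G)}=\sup\{\|Af\|_{L^q(G)} : f\in \mathrm{Dom}(A),\ \|f\|_{L^p(G)}\le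 1\}$, the right-hand side may be $+\infty$, an empty sum is $0$, and $0^0=0$, $0\cdot\infty=0$, $\infty^0=1$. -/

import Mathlib

open MeasureTheory
open scoped ENNReal NNReal Manifold ContDiff Matrix

noncomputable section

namespace CompactMultiplier

variable {G : Type*} [Group G]

/-- The linear representation of `G` on `ℂ^d` given by a homomorphism to unitary matrices. -/
def matrixRep {d : ℕ} (ρ : G →* Matrix.unitaryGroup (Fin d) ℂ) :
    Representation ℂ G (Fin d → ℂ) where
  toFun g := Matrix.toLin' (ρ g : Matrix (Fin d) (Fin d) ℂ)
  map_one' := by simp; rfl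
  map_mul' g h := by simp [Matrix.toLin'_mul]; rfl

variable [TopologicalSpace G]

variable (G) in
/-- Continuous irreducible unitary (matrix) representations of `G`. For a compact group every
continuous irreducible unitary representation on a Hilbert space is finite-dimensional, hence
unitarily equivalent to one of these. -/
structure UnitaryIrrep where
  /-- the dimension `d_ξ` -/
  dim : ℕ
  /-- the representation `ξ : G → U(d_ξ)` -/
  hom : G →* Matrix.unitaryGroup (Fin dim) ℂ
  continuous_hom : Continuous hom
  irreducible : (matrixRep hom).IsIrreducible

/-- The matrix `ξ(x)`. -/
def UnitaryIrrep.mat (ξ : UnitaryIrrep G) (x : G) : Matrix (Fin ξ.dim) (Fin ξ.dim) ℂ :=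
  (ξ.hom x : Matrix (Fin ξ.dim) (Fin ξ.dim) ℂ)

/-- Unitary equivalence of representations. -/
def UnitaryIrrep.Equivalent (ξ η : UnitaryIrrep G) : Prop :=
  ∃ T : Matrix (Fin η.dim) (Fin ξ.dim) ℂ,
    Tᴴ * T = 1 ∧ T * Tᴴ = 1 ∧ ∀ x, T * ξ.mat x = η.mat x * T

variable (G) in
/-- Unitary equivalence as a setoid. -/
def UnitaryIrrep.setoid : Setoid (UnitaryIrrep G) where
  r := UnitaryIrrep.Equivalent
  iseqv := {
    refl := fun ξ => ⟨1, by simp, by simp, by simp⟩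
    symm := by
      rintro ξ η ⟨T, h1, h2, h3⟩
      refine ⟨Tᴴ, by simpa using h2, by simpa using h1, fun x => ?_⟩
      calc Tᴴ * η.mat x = Tᴴ * (η.mat x * T) * Tᴴ := by
            rw [Matrix.mul_assoc, Matrix.mul_assoc, h2, Matrix.mul_one]
        _ = (Tᴴ * T) * ξ.mat x * Tᴴ := by rw [← h3, ← Matrix.mul_assoc]
        _ = ξ.mat x * Tᴴ := by rw [h1, Matrix.one_mul]
    trans := by
      rintro ξ η ζ ⟨T, h1, h2, h3⟩ ⟨S, k1, k2, k3⟩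
      refine ⟨S * T, ?_, ?_, fun x => ?_⟩
      · rw [Matrix.conjTranspose_mul, Matrix.mul_assoc, ← Matrix.mul_assoc _ S T, k1,
          Matrix.one_mul, h1]
      · rw [Matrix.conjTranspose_mul, Matrix.mul_assoc, ← Matrix.mul_assoc T, h2,
          Matrix.one_mul, k2]
      · rw [Matrix.mul_assoc, h3, ← Matrix.mul_assoc, k3, Matrix.mul_assoc] }

variable (G) in
/-- The unitary dual `Ĝ`: equivalence classes of continuous irreducible unitary representations. -/
def UnitaryDual : Type _ := Quotient (UnitaryIrrep.setoid G)

/-- A representative of a class in the unitary dual. -/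
def UnitaryDual.rep (ξ : UnitaryDual G) : UnitaryIrrep G := Quotient.out ξ

/-- The matrix coefficient `x ↦ ξ(x)_{ij}` as a continuous function. -/
def UnitaryIrrep.coeff (ξ : UnitaryIrrep G) (i j : Fin ξ.dim) : C(G, ℂ) where
  toFun x := ξ.mat x i j
  continuous_toFun :=
    (continuous_subtype_val.comp ξ.continuous_hom).matrix_elem i j

variable [IsTopologicalGroup G] [MeasurableSpace G] [BorelSpace G]

/-- Left translation `f ↦ f(g⁻¹ ·)` on `L²(G)`. -/
def leftTranslate (μ : Measure G) [μ.IsMulLeftInvariant] (g : G) (f : Lp ℂ 2 μ) : Lp ℂ 2 μ :=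
  Lp.compMeasurePreserving (fun x => g⁻¹ * x) (measurePreserving_mul_left μ g⁻¹) f

/-- Left Fourier multipliers on a compact group: the (possibly unbounded) closed densely defined
operators on `L²(G)` that commute with all left translations. -/
structure IsLeftFourierMultiplier (μ : Measure G) [μ.IsMulLeftInvariant]
    (A : Lp ℂ 2 μ →ₗ.[ℂ] Lp ℂ 2 μ) : Prop where
  dense_domain : Dense (A.domain : Set (Lp ℂ 2 μ))
  isClosed : A.IsClosed
  left_invariant : ∀ (g : G) (f : A.domain), ∃ h : leftTranslate μ g f ∈ A.domain,
    A ⟨leftTranslate μ g f, h⟩ = leftTranslate μ g (A f)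

/-- `‖A‖_{L^p → L^q}`, the supremum of `‖A f‖_q` over `f` in the domain with `‖f‖_p ≤ 1`. -/
def lpLqNorm (μ : Measure G) (A : Lp ℂ 2 μ →ₗ.[ℂ] Lp ℂ 2 μ) (p q : ℝ) : ℝ≥0∞ :=
  ⨆ (f : A.domain) (_ : eLpNorm ((f : Lp ℂ 2 μ) : G → ℂ) (ENNReal.ofReal p) μ ≤ 1),
    eLpNorm (A f : G → ℂ) (ENNReal.ofReal q) μ

variable [CompactSpace G]

open Classical in
/-- `A` applied to the matrix coefficient `ξ_{ij}`. (All matrix coefficients lie in the domain of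
a closed densely defined left-invariant operator, so the value `0` is never used for these.) -/
def applyCoeff (μ : Measure G) [IsFiniteMeasure μ] (A : Lp ℂ 2 μ →ₗ.[ℂ] Lp ℂ 2 μ)
    (ξ : UnitaryIrrep G) (i j : Fin ξ.dim) : Lp ℂ 2 μ :=
  if h : ContinuousMap.toLp 2 μ ℂ (ξ.coeff i j) ∈ A.domain then
    A ⟨ContinuousMap.toLp 2 μ ℂ (ξ.coeff i j), h⟩
  else 0

/-- The global matrix symbol `σ_A(ξ) = ξ(x)* (Aξ)(x)`, where `A` acts on `ξ` entrywise. For a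
left-invariant operator the right-hand side is independent of `x` (almost everywhere); its
constant value is obtained as the mean over `G`, with `μ` the Haar probability measure. -/
def symbol (μ : Measure G) [IsFiniteMeasure μ] (A : Lp ℂ 2 μ →ₗ.[ℂ] Lp ℂ 2 μ)
    (ξ : UnitaryIrrep G) : Matrix (Fin ξ.dim) (Fin ξ.dim) ℂ :=
  Matrix.of fun k j => ∫ x, ∑ i, (ξ.mat x)ᴴ k i * applyCoeff μ A ξ i j x ∂μ

/-- The operator norm of `σ_A(ξ)` on the Hilbert space `ℂ^{d_ξ}`. -/
def symbolNorm (μ : Measure G) [IsFiniteMeasure μ] (A : Lp ℂ 2 μ →ₗ.[ℂ] Lp ℂ 2 μ)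
    (ξ : UnitaryIrrep G) : ℝ≥0 :=
  ‖Matrix.toEuclideanCLM (n := Fin ξ.dim) (𝕜 := ℂ) (symbol μ A ξ)‖₊

/-- `∑ d_ξ²` over the `ξ ∈ Ĝ` with `‖σ_A(ξ)‖ ≥ s`. -/
def levelSum (μ : Measure G) [IsFiniteMeasure μ] (A : Lp ℂ 2 μ →ₗ.[ℂ] Lp ℂ 2 μ)
    (s : ℝ≥0) : ℝ≥0∞ :=
  ∑' ξ : {ξ : UnitaryDual G // s ≤ symbolNorm μ A ξ.rep}, (ξ.1.rep.dim : ℝ≥0∞) ^ 2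

open Classical in
/-- The power `x ^ r` for `r ≥ 0`, with the convention `0 ^ 0 = 0`. -/
def powZ (x : ℝ≥0∞) (r : ℝ) : ℝ≥0∞ := if x = 0 then 0 else x ^ r

end CompactMultiplier

end

set_option linter.unusedSectionVars false

noncomputable section

namespace CompactMultiplier

/-! ### Finite-dimensional invariant subspaces of isometric representations -/

section FiniteDimensional

variable {G : Type*} [Group G]
  {E : Type*} [NormedAddCommGroup E] [InnerProductSpace ℂ E]

/-! On the Fourier side `A` multiplies each coefficient matrix of `f` by its symbol. Peter–Weyl and
Schur orthogonality make the functions √d_ξ ξ_{ij} a Hilbert basis (`coeffBasis`). Left invariance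
and closedness force `A` to act on each block by `symbol`
(`IsLeftFourierMultiplier.inner_lpCoeff_apply`), so the block mass m_f(ξ) = d_ξ ‖f̂(ξ)‖²_HS grows at
most by the factor ‖σ_A(ξ)‖².

The quantitative input is Paley's inequality (`IsSquareMass.paley`). If u on the dual is in weak ℓ¹
for the weights d_ξ², with constant 1, then ∑ u(ξ)^{2/p-1} m_f(ξ) ≤ C_p whenever ‖f‖_p ≤ 1 and 1 < p
≤ 2. It is a real interpolation between Bessel's inequality ∑ m_f ≤ ‖f‖₂² and the bound m_f(ξ) ≤
d_ξ² ‖f‖₁²: at the dyadic level u ~ 2^k, the function is cut at height 2^{-k/p}.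

Put δ = 1/p - 1/q and suppose the supremum on the right is at most M. For δ > 0, the weight u =
(‖σ_A‖/M)^{1/δ} is of weak type ℓ¹ (`exists_weight`). With q' = q/(q-1), the exponents satisfy (2/p
- 1) + (2/q' - 1) = 2δ, so ‖σ_A‖² = M² u^{2/p-1} u^{2/q'-1}. Expanding ⟨h, Af⟩ in the basis and
splitting products by a weighted arithmetic-geometric inequality bounds the pairing by M times the
Paley sums of f at p and of h at q' (`IsLeftFourierMultiplier.enorm_inner_apply_le`). Duality
between L^q and L^{q'} (`lintegral_rpow_le_of_dual`) concludes. -/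

lemma inner_eq_inner_inv (R : G →* (E →ₗᵢ[ℂ] E)) (g : G) (u v : E) :
    inner ℂ u (R g v) = inner ℂ (R g⁻¹ u) v := by
  rw [← (R g⁻¹).inner_map_map u (R g v), ← Function.comp_apply (f := R g⁻¹) (g := R g),
    ← LinearIsometry.coe_mul, ← map_mul]
  simp

/-- The matrix of `R g` on an invariant subspace in an orthonormal basis. -/
def subspaceMatrix {d : ℕ} (R : G →* (E →ₗᵢ[ℂ] E)) (W : Submodule ℂ E)
    (b : OrthonormalBasis (Fin d) ℂ W) (g : G) : Matrix (Fin d) (Fin d) ℂ :=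
  Matrix.of fun i j => inner ℂ (b i : E) (R g (b j : E))

lemma sum_subspaceMatrix_smul {d : ℕ} (R : G →* (E →ₗᵢ[ℂ] E)) {W : Submodule ℂ E}
    (hW : ∀ g, ∀ u ∈ W, R g u ∈ W) (b : OrthonormalBasis (Fin d) ℂ W) (g : G) (j : Fin d) :
    ∑ i, subspaceMatrix R W b g i j • (b i : E) = R g (b j) := by
  have h := b.sum_repr' ⟨R g (b j), hW g _ (b j).2⟩
  simpa [subspaceMatrix] using congrArg (Subtype.val) h

lemma subspaceMatrix_mul {d : ℕ} (R : G →* (E →ₗᵢ[ℂ] E)) {W : Submodule ℂ E}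
    (hW : ∀ g, ∀ u ∈ W, R g u ∈ W) (b : OrthonormalBasis (Fin d) ℂ W) (g h : G) :
    subspaceMatrix R W b (g * h) = subspaceMatrix R W b g * subspaceMatrix R W b h := by
  ext i k
  rw [Matrix.mul_apply]
  have h1 : R (g * h) (b k : E) = R g (R h (b k)) := by rw [map_mul]; rfl
  simp only [subspaceMatrix, Matrix.of_apply]
  rw [h1]
  nth_rewrite 1 [← sum_subspaceMatrix_smul R hW b h k]
  rw [map_sum, inner_sum]
  refine Finset.sum_congr rfl fun j _ => ?_
  rw [map_smul, inner_smul_right, mul_comm]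
  rfl

lemma subspaceMatrix_one {d : ℕ} (R : G →* (E →ₗᵢ[ℂ] E)) {W : Submodule ℂ E}
    (b : OrthonormalBasis (Fin d) ℂ W) : subspaceMatrix R W b 1 = 1 := by
  ext i j
  simp only [subspaceMatrix, Matrix.of_apply, map_one, LinearIsometry.coe_one, id_eq]
  rw [← Submodule.coe_inner, orthonormal_iff_ite.mp b.orthonormal, Matrix.one_apply]

lemma subspaceMatrix_conjTranspose {d : ℕ} (R : G →* (E →ₗᵢ[ℂ] E)) {W : Submodule ℂ E}
    (b : OrthonormalBasis (Fin d) ℂ W) (g : G) :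
    (subspaceMatrix R W b g)ᴴ = subspaceMatrix R W b g⁻¹ := by
  ext i j
  simp only [subspaceMatrix, Matrix.conjTranspose_apply, Matrix.of_apply]
  rw [inner_eq_inner_inv R g, ← starRingEnd_apply, inner_conj_symm]

lemma subspaceMatrix_mem_unitaryGroup {d : ℕ} (R : G →* (E →ₗᵢ[ℂ] E)) {W : Submodule ℂ E}
    (hW : ∀ g, ∀ u ∈ W, R g u ∈ W) (b : OrthonormalBasis (Fin d) ℂ W) (g : G) :
    subspaceMatrix R W b g ∈ Matrix.unitaryGroup (Fin d) ℂ := by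
  rw [Matrix.mem_unitaryGroup_iff, Matrix.star_eq_conjTranspose, subspaceMatrix_conjTranspose,
    ← subspaceMatrix_mul R hW, mul_inv_cancel, subspaceMatrix_one]

/-- The unitary matrix representation on a finite-dimensional invariant subspace. -/
def subspaceHom {d : ℕ} (R : G →* (E →ₗᵢ[ℂ] E)) {W : Submodule ℂ E}
    (hW : ∀ g, ∀ u ∈ W, R g u ∈ W) (b : OrthonormalBasis (Fin d) ℂ W) :
    G →* Matrix.unitaryGroup (Fin d) ℂ where
  toFun g := ⟨subspaceMatrix R W b g, subspaceMatrix_mem_unitaryGroup R hW b g⟩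
  map_one' := Subtype.ext (subspaceMatrix_one R b)
  map_mul' g h := Subtype.ext (subspaceMatrix_mul R hW b g h)

variable [TopologicalSpace G]

variable (G) in
/-- The linear span of the matrix coefficients of continuous irreducible unitary
representations. -/
def coeffSpan : Submodule ℂ C(G, ℂ) :=
  Submodule.span ℂ {f | ∃ (ξ : UnitaryIrrep G) (i j : Fin ξ.dim), f = ξ.coeff i j}

/-- The function `g ↦ ⟪κ, R g u⟫` of a strongly continuous isometric representation `R`. -/
def matrixElement (R : G →* (E →ₗᵢ[ℂ] E)) (hR : ∀ u, Continuous fun g => R g u) (κ u : E) :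
    C(G, ℂ) where
  toFun g := inner ℂ κ (R g u)
  continuous_toFun := continuous_const.inner (hR u)

@[simp]
lemma matrixElement_apply (R : G →* (E →ₗᵢ[ℂ] E)) (hR : ∀ u, Continuous fun g => R g u)
    (κ u : E) (g : G) : matrixElement R hR κ u g = inner ℂ κ (R g u) := rfl

lemma continuous_subspaceHom {d : ℕ} (R : G →* (E →ₗᵢ[ℂ] E))
    (hR : ∀ u, Continuous fun g => R g u) {W : Submodule ℂ E}
    (hW : ∀ g, ∀ u ∈ W, R g u ∈ W) (b : OrthonormalBasis (Fin d) ℂ W) :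
    Continuous (subspaceHom R hW b) :=
  Continuous.subtype_mk (continuous_matrix fun _ _ => continuous_const.inner (hR _)) _

lemma isIrreducible_subspaceHom {d : ℕ} (R : G →* (E →ₗᵢ[ℂ] E)) {W : Submodule ℂ E}
    (hW : ∀ g, ∀ u ∈ W, R g u ∈ W) (b : OrthonormalBasis (Fin d) ℂ W) (hne : W ≠ ⊥)
    (hirr : ∀ U ≤ W, (∀ g, ∀ u ∈ U, R g u ∈ U) → U = ⊥ ∨ U = W) :
    (matrixRep (subspaceHom R hW b)).IsIrreducible := by
  let e : (Fin d → ℂ) →ₗ[ℂ] E := Fintype.linearCombination ℂ fun i => (b i : E)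
  have he : ∀ v, e v = ∑ i, v i • (b i : E) := fun v => rfl
  have hrange : ∀ w ∈ W, ∃ v, e v = w := fun w hw =>
    ⟨fun i => inner ℂ (b i) (⟨w, hw⟩ : W), by
      simpa [he] using congrArg Subtype.val (b.sum_repr' ⟨w, hw⟩)⟩
  have hinj : Function.Injective e := by
    have : LinearIndependent ℂ fun i => (b i : E) := by
      simpa [Function.comp_def] using
        b.toBasis.linearIndependent.map' W.subtype W.ker_subtype
    exact this.fintypeLinearCombination_injective
  have hint : ∀ g v, e (matrixRep (subspaceHom R hW b) g v) = R g (e v) := by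
    intro g v
    rw [he, he, map_sum]
    simp_rw [map_smul, ← sum_subspaceMatrix_smul R hW b, Finset.smul_sum]
    rw [Finset.sum_comm]
    refine Finset.sum_congr rfl fun i _ => ?_
    simp only [matrixRep, subspaceHom, MonoidHom.coe_mk, OneHom.coe_mk, Matrix.toLin'_apply,
      Matrix.mulVec, dotProduct, Finset.sum_smul, smul_smul]
    exact Finset.sum_congr rfl fun j _ => by rw [mul_comm]
  have hmem : ∀ v, e v ∈ W := fun v => by
    rw [he]
    exact Submodule.sum_mem _ fun i _ => Submodule.smul_mem _ _ (b i).2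
  have key : ∀ U : Subrepresentation (matrixRep (subspaceHom R hW b)), U = ⊥ ∨ U = ⊤ := by
    intro U
    rcases hirr (U.toSubmodule.map e) (by rintro _ ⟨v, _, rfl⟩; exact hmem v) (by
      rintro g _ ⟨v, hv, rfl⟩
      exact ⟨_, U.apply_mem_toSubmodule g hv, hint g v⟩) with h | h
    · left
      apply Subrepresentation.toSubmodule_injective
      refine (Submodule.eq_bot_iff _).mpr fun v hv => hinj ?_
      rw [map_zero, ← Submodule.mem_bot ℂ, ← h]
      exact Submodule.mem_map_of_mem hv
    · right
      apply Subrepresentation.toSubmodule_injective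
      refine eq_top_iff.mpr fun v _ => ?_
      obtain ⟨v', hv', h'⟩ := h.ge (hmem v)
      exact hinj h' ▸ hv'
  obtain ⟨w, hw, hw0⟩ := (Submodule.ne_bot_iff W).mp hne
  obtain ⟨v, rfl⟩ := hrange w hw
  have hnt : Nontrivial (Subrepresentation (matrixRep (subspaceHom R hW b))) := by
    refine ⟨⊥, ⊤, fun h => hw0 ?_⟩
    have h2 : v ∈ (⊤ : Subrepresentation (matrixRep (subspaceHom R hW b))).toSubmodule :=
      Submodule.mem_top
    rw [← h] at h2
    rw [(Submodule.mem_bot ℂ).mp h2, map_zero]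
  exact { eq_bot_or_eq_top := key }

lemma matrixElement_mem_coeffSpan_of_irreducible (R : G →* (E →ₗᵢ[ℂ] E))
    (hR : ∀ u, Continuous fun g => R g u) {W : Submodule ℂ E} [FiniteDimensional ℂ W]
    (hW : ∀ g, ∀ u ∈ W, R g u ∈ W) (hne : W ≠ ⊥)
    (hirr : ∀ U ≤ W, (∀ g, ∀ u ∈ U, R g u ∈ U) → U = ⊥ ∨ U = W) (κ : E) {u : E} (hu : u ∈ W) :
    matrixElement R hR κ u ∈ coeffSpan G := by
  let b := stdOrthonormalBasis ℂ W
  let ξ : UnitaryIrrep G :=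
    ⟨_, subspaceHom R hW b, continuous_subspaceHom R hR hW b,
      isIrreducible_subspaceHom R hW b hne hirr⟩
  have h : matrixElement R hR κ u =
      ∑ j, ∑ i, (inner ℂ (b j : E) u * inner ℂ κ (b i : E)) • ξ.coeff i j := by
    ext g
    have h1 : u = ∑ j, inner ℂ (b j : E) u • (b j : E) := by
      simpa using congrArg Subtype.val (b.sum_repr' ⟨u, hu⟩).symm
    rw [matrixElement_apply]
    nth_rewrite 1 [h1]
    simp only [map_sum, inner_sum, map_smul, inner_smul_right, ContinuousMap.sum_apply,
      ContinuousMap.smul_apply, smul_eq_mul]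
    refine Finset.sum_congr rfl fun j _ => ?_
    rw [← sum_subspaceMatrix_smul R hW b g j, inner_sum, Finset.mul_sum]
    refine Finset.sum_congr rfl fun i _ => ?_
    rw [inner_smul_right, mul_assoc, mul_comm (inner ℂ κ _)]
    rfl
  rw [h]
  exact Submodule.sum_mem _ fun j _ => Submodule.sum_mem _ fun i _ =>
    Submodule.smul_mem _ _ (Submodule.subset_span ⟨ξ, i, j, rfl⟩)

/-- Matrix elements of vectors in a finite-dimensional invariant subspace of a unitary
representation are combinations of matrix coefficients of irreducible representations. -/
theorem matrixElement_mem_coeffSpan (R : G →* (E →ₗᵢ[ℂ] E))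
    (hR : ∀ u, Continuous fun g => R g u) (κ : E) (W : Submodule ℂ E) [FiniteDimensional ℂ W]
    (hW : ∀ g, ∀ u ∈ W, R g u ∈ W) {u : E} (hu : u ∈ W) :
    matrixElement R hR κ u ∈ coeffSpan G := by
  induction hn : Module.finrank ℂ W using Nat.strong_induction_on generalizing W u with
  | _ n ih =>
    subst hn
    by_cases hne : W = ⊥
    · have : u = 0 := by simpa [hne] using hu
      have h0 : matrixElement R hR κ u = 0 := by ext g; simp [this]
      rw [h0]; exact Submodule.zero_mem _
    by_cases hirr : ∀ U ≤ W, (∀ g, ∀ u ∈ U, R g u ∈ U) → U = ⊥ ∨ U = W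
    · exact matrixElement_mem_coeffSpan_of_irreducible R hR hW hne hirr κ hu
    push Not at hirr
    obtain ⟨U, hUW, hU, hU0, hU1⟩ := hirr
    have : FiniteDimensional ℂ U := Submodule.finiteDimensional_of_le hUW
    have : FiniteDimensional ℂ (Uᗮ ⊓ W : Submodule ℂ E) :=
      Submodule.finiteDimensional_of_le inf_le_right
    have hsup : U ⊔ Uᗮ ⊓ W = W := Submodule.sup_orthogonal_inf_of_hasOrthogonalProjection hUW
    -- Complete reducibility: as `R g` is isometric with inverse `R g⁻¹`, the orthogonal complement
    -- of an invariant subspace is invariant, and both summands have smaller dimension.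
    have hU' : ∀ g, ∀ u ∈ Uᗮ ⊓ W, R g u ∈ Uᗮ ⊓ W := fun g u hu =>
      ⟨fun v hv => by rw [inner_eq_inner_inv]; exact hu.1 _ (hU _ _ hv), hW g u hu.2⟩
    have hlt : Uᗮ ⊓ W < W := by
      refine lt_of_le_of_ne inf_le_right fun h => hU0 ?_
      rw [Submodule.eq_bot_iff]
      intro v hv
      have h2 : v ∈ Uᗮ ⊓ W := h.ge (hUW hv)
      exact inner_self_eq_zero.mp (h2.1 v hv)
    rw [← hsup] at hu
    obtain ⟨v, hv, w, hw, rfl⟩ := Submodule.mem_sup.mp hu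
    have hadd : matrixElement R hR κ (v + w) =
        matrixElement R hR κ v + matrixElement R hR κ w := by
      ext g; simp
    rw [hadd]
    exact Submodule.add_mem _
      (ih _ (Submodule.finrank_lt_finrank_of_lt (lt_of_le_of_ne hUW hU1)) U hU hv rfl)
      (ih _ (Submodule.finrank_lt_finrank_of_lt hlt) _ hU' hw rfl)

end FiniteDimensional

/-! ### The Peter–Weyl theorem via compact convolution operators -/

section PeterWeyl

variable {G : Type*} [Group G] [TopologicalSpace G] [IsTopologicalGroup G] [CompactSpace G]
  [MeasurableSpace G] [BorelSpace G]

/-- Compact groups are unimodular: a right translate of `μ` is again a Haar probability measure, and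
there is only one. -/
lemma isMulRightInvariant_of_isHaarMeasure (μ : Measure G) [μ.IsHaarMeasure]
    [IsProbabilityMeasure μ] : μ.IsMulRightInvariant where
  map_mul_right_eq_self g := by
    have : IsProbabilityMeasure (μ.map (· * g)) :=
      Measure.isProbabilityMeasure_map (measurable_mul_const g).aemeasurable
    exact Measure.isHaarMeasure_eq_of_isProbabilityMeasure _ _

/-- Right translation `f ↦ f(· g)` on `L²(G)`. -/
def rightTranslate (μ : Measure G) [μ.IsMulRightInvariant] :
    G →* (Lp ℂ 2 μ →ₗᵢ[ℂ] Lp ℂ 2 μ) where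
  toFun g := Lp.compMeasurePreservingₗᵢ ℂ (fun x => x * g) (measurePreserving_mul_right μ g)
  map_one' := by
    ext1 f
    refine Lp.ext ?_
    have := Lp.coeFn_compMeasurePreserving f (measurePreserving_mul_right μ (1 : G))
    refine this.trans (Filter.Eventually.of_forall fun x => ?_)
    simp
  map_mul' g h := by
    ext1 f
    have := Lp.compMeasurePreserving_comp_apply f (measurePreserving_mul_right μ h)
      (measurePreserving_mul_right μ g)
    refine Eq.trans ?_ this
    change Lp.compMeasurePreserving _ _ f = _
    congr 1
    congr 1
    ext x
    simp [mul_assoc]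

variable (μ : Measure G) [μ.IsHaarMeasure] [IsProbabilityMeasure μ] [μ.IsMulRightInvariant]

lemma rightTranslate_toLp (g : G) (f : C(G, ℂ)) :
    rightTranslate μ g (ContinuousMap.toLp 2 μ ℂ f) =
      ContinuousMap.toLp 2 μ ℂ (f.comp ⟨fun x => x * g, continuous_mul_const g⟩) := by
  refine Lp.ext ?_
  refine (Lp.coeFn_compMeasurePreserving _ (measurePreserving_mul_right μ g)).trans ?_
  refine ((measurePreserving_mul_right μ g).quasiMeasurePreserving.ae_eq_comp
    (ContinuousMap.coeFn_toLp μ f)).trans ?_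
  exact (ContinuousMap.coeFn_toLp (E := ℂ) (𝕜 := ℂ) (p := 2) μ
    (f.comp ⟨fun x => x * g, continuous_mul_const g⟩)).symm

lemma continuous_rightTranslate (f : Lp ℂ 2 μ) : Continuous fun g => rightTranslate μ g f := by
  let F : C(G, C(G, G)) := ContinuousMap.curry ⟨fun p : G × G => p.2 * p.1, by fun_prop⟩
  exact Continuous.compMeasurePreservingLp (f := fun _ : G => f) continuous_const F.continuous
    (fun g => measurePreserving_mul_right μ g) (by simp)

/-- The operator `f ↦ (g ↦ ⟪κ, R_g f⟫)` from `L²(G)` to `C(G)`. -/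
def kernelMap (κ : Lp ℂ 2 μ) : Lp ℂ 2 μ →L[ℂ] C(G, ℂ) :=
  LinearMap.mkContinuous
    { toFun := matrixElement (rightTranslate μ) (continuous_rightTranslate μ) κ
      map_add' := fun u v => by ext g; simp
      map_smul' := fun c u => by ext g; simp } ‖κ‖ fun u => by
    refine (ContinuousMap.norm_le _ (by positivity)).mpr fun g => ?_
    have h := norm_inner_le_norm (𝕜 := ℂ) κ (rightTranslate μ g u)
    rwa [LinearIsometry.norm_map] at h

@[simp]
lemma kernelMap_apply (κ u : Lp ℂ 2 μ) (g : G) :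
    kernelMap μ κ u g = inner ℂ κ (rightTranslate μ g u) := rfl

/-- Arzelà–Ascoli. Moving the translation onto κ bounds the oscillation between x and y, uniformly
over the unit ball, by ‖R_{x⁻¹}κ - R_{y⁻¹}κ‖; equicontinuity is thus strong continuity of
translation at the single vector κ. -/
lemma isCompactOperator_kernelMap (κ : Lp ℂ 2 μ) : IsCompactOperator (kernelMap μ κ) := by
  let e := ContinuousMap.isometryEquivBoundedOfCompact G ℂ
  let S : Set (BoundedContinuousFunction G ℂ) :=
    e '' (kernelMap μ κ '' Metric.closedBall 0 1)
  have hS : IsCompact (closure S) := by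
    refine BoundedContinuousFunction.arzela_ascoli (Metric.closedBall 0 ‖κ‖)
      (isCompact_closedBall _ _) S ?_ ?_
    · rintro _ x ⟨_, ⟨u, hu, rfl⟩, rfl⟩
      rw [mem_closedBall_zero_iff] at hu ⊢
      change ‖kernelMap μ κ u x‖ ≤ _
      rw [kernelMap_apply]
      refine (norm_inner_le_norm _ _).trans ?_
      rw [LinearIsometry.norm_map]
      exact mul_le_of_le_one_right (norm_nonneg _) hu
    · intro x
      refine Metric.equicontinuousAt_iff_right.mpr fun ε hε => ?_
      have hc : Continuous fun g : G => rightTranslate μ g⁻¹ κ :=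
        (continuous_rightTranslate μ κ).comp continuous_inv
      filter_upwards [Metric.tendsto_nhds.mp (hc.tendsto x) ε hε] with y hy
      rintro ⟨_, _, ⟨u, hu, rfl⟩, rfl⟩
      rw [mem_closedBall_zero_iff] at hu
      change dist (kernelMap μ κ u x) (kernelMap μ κ u y) < ε
      rw [dist_comm, dist_eq_norm] at *
      rw [kernelMap_apply, kernelMap_apply, inner_eq_inner_inv, inner_eq_inner_inv _ x,
        ← inner_sub_left]
      refine (norm_inner_le_norm _ _).trans_lt (lt_of_le_of_lt ?_ hy)
      exact (mul_le_of_le_one_right (norm_nonneg _) hu).trans_eq (norm_sub_rev _ _)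
  refine (isCompactOperator_iff_image_closedBall_subset_compact
    (kernelMap μ κ : Lp ℂ 2 μ →ₗ[ℂ] C(G, ℂ)) one_pos).mpr
      ⟨e ⁻¹' closure S, ?_, fun f hf => subset_closure ⟨f, hf, rfl⟩⟩
  exact e.toHomeomorph.isCompact_preimage.mpr hS

/-- The operator `kernelMap` with values in `L²(G)`. -/
def kernelOperator (κ : Lp ℂ 2 μ) : Lp ℂ 2 μ →L[ℂ] Lp ℂ 2 μ :=
  (ContinuousMap.toLp 2 μ ℂ).comp (kernelMap μ κ)

lemma isCompactOperator_kernelOperator (κ : Lp ℂ 2 μ) :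
    IsCompactOperator (kernelOperator μ κ) :=
  (isCompactOperator_kernelMap μ κ).clm_comp (ContinuousMap.toLp 2 μ ℂ)

/-- This makes the eigenspaces of the kernel operator invariant under right translation. -/
lemma kernelOperator_rightTranslate (κ u : Lp ℂ 2 μ) (g : G) :
    kernelOperator μ κ (rightTranslate μ g u) = rightTranslate μ g (kernelOperator μ κ u) := by
  simp only [kernelOperator, ContinuousLinearMap.comp_apply, rightTranslate_toLp]
  congr 1
  ext h
  simp [map_mul]

/-- On continuous functions the operator has integral kernel k(gx⁻¹), which is Hermitian under `hk`;
Fubini gives symmetry there, and density extends it to L². -/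
lemma isSymmetric_kernelOperator (k : C(G, ℂ)) (hk : ∀ x, k x⁻¹ = (starRingEnd ℂ) (k x)) :
    (kernelOperator μ (ContinuousMap.toLp 2 μ ℂ k)).IsSymmetric := by
  set T := kernelOperator μ (ContinuousMap.toLp 2 μ ℂ k) with hT
  let J := ContinuousMap.toLp (E := ℂ) 2 μ ℂ
  have hval : ∀ (u : C(G, ℂ)) (g : G), kernelMap μ (ContinuousMap.toLp 2 μ ℂ k)
      (ContinuousMap.toLp 2 μ ℂ u) g = ∫ x, u x * k (g * x⁻¹) ∂μ := by
    intro u g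
    rw [kernelMap_apply, rightTranslate_toLp, ContinuousMap.inner_toLp]
    rw [← integral_mul_right_eq_self _ g⁻¹]
    simp [← hk]
  have hcont : ∀ u v : C(G, ℂ),
      inner ℂ (T (J u)) (J v) = inner ℂ (J u) (T (J v)) := by
    intro u v
    simp only [hT, J, kernelOperator, ContinuousLinearMap.comp_apply]
    rw [ContinuousMap.inner_toLp, ContinuousMap.inner_toLp]
    simp_rw [hval, ← integral_conj, ← integral_const_mul, ← integral_mul_const]
    rw [integral_integral_swap_of_hasCompactSupport]
    · refine integral_congr_ae (Filter.Eventually.of_forall fun x => ?_)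
      refine integral_congr_ae (Filter.Eventually.of_forall fun y => ?_)
      simp only [map_mul, ← hk]
      simp
      ring
    · have hc : Continuous (starRingEnd ℂ) := Complex.continuous_conj
      fun_prop
    · exact HasCompactSupport.of_compactSpace _
  have hd : DenseRange J := ContinuousMap.toLp_denseRange ℂ μ ℂ (by simp)
  intro u v
  change inner ℂ (T u) v = inner ℂ u (T v)
  refine hd.induction_on (p := fun u => inner ℂ (T u) v = inner ℂ u (T v)) u
    (isClosed_eq (by fun_prop) (by fun_prop)) fun u => ?_
  exact hd.induction_on (p := fun v => inner ℂ (T (J u)) v = inner ℂ (J u) (T v)) v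
    (isClosed_eq (by fun_prop) (by fun_prop)) fun v => hcont u v

/-- By the spectral theorem it suffices that Tf is orthogonal to every eigenvector e, where ⟨e, Tf⟩
= ⟨Te, f⟩. If the eigenvalue is 0, then Te = 0. Otherwise the eigenspace is finite-dimensional and
translation invariant, so Te is a matrix element lying in `coeffSpan G`, to which f is orthogonal.
-/
lemma inner_coeffSpan_eq_zero_imp_kernelOperator_eq_zero (k : C(G, ℂ))
    (hk : ∀ x, k x⁻¹ = (starRingEnd ℂ) (k x)) {f : Lp ℂ 2 μ}
    (hf : ∀ c ∈ coeffSpan G, inner ℂ (ContinuousMap.toLp 2 μ ℂ c) f = 0) :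
    kernelOperator μ (ContinuousMap.toLp 2 μ ℂ k) f = 0 := by
  set κ := ContinuousMap.toLp (E := ℂ) 2 μ ℂ k with hκ
  set T := kernelOperator μ κ with hT
  have hsym : T.IsSymmetric := isSymmetric_kernelOperator μ k hk
  have hcpt : IsCompactOperator T := isCompactOperator_kernelOperator μ κ
  have h := T.orthogonalComplement_iSup_eigenspaces_eq_bot hcpt hsym
  rw [← Submodule.mem_bot ℂ, ← h, Submodule.mem_orthogonal]
  intro u hu
  refine Submodule.iSup_induction _ (motive := fun u => inner ℂ u (T f) = 0) hu ?_ (by simp)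
    fun x y hx hy => by rw [inner_add_left, hx, hy, add_zero]
  intro l e he
  have hTe : T e = l • e := Module.End.mem_eigenspace_iff.mp he
  have h1 : inner ℂ e (T f) = inner ℂ (T e) f := (hsym e f).symm
  rw [h1]
  by_cases hl : l = 0
  · rw [hTe, hl, zero_smul, inner_zero_left]
  have hfin : FiniteDimensional ℂ (Module.End.eigenspace (T : Module.End ℂ (Lp ℂ 2 μ)) l) :=
    T.finite_dimensional_eigenspace hcpt l hl
  exact hf _ (matrixElement_mem_coeffSpan (rightTranslate μ) (continuous_rightTranslate μ) κ
    (Module.End.eigenspace (T : Module.End ℂ (Lp ℂ 2 μ)) l) (fun g u hu => by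
      rw [Module.End.mem_eigenspace_iff] at hu ⊢
      change T _ = _
      rw [hT, kernelOperator_rightTranslate, ← map_smul]
      exact congrArg _ hu) he)

/-- **Peter–Weyl**: an `L²` function orthogonal to all matrix coefficients vanishes. -/
theorem eq_zero_of_inner_coeffSpan_eq_zero {f : Lp ℂ 2 μ}
    (hf : ∀ c ∈ coeffSpan G, inner ℂ (ContinuousMap.toLp 2 μ ℂ c) f = 0) : f = 0 := by
  have hsym : ∀ k : C(G, ℂ), (∀ x, k x⁻¹ = (starRingEnd ℂ) (k x)) →
      inner ℂ (ContinuousMap.toLp 2 μ ℂ k) f = 0 := by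
    intro k hk
    have h := inner_coeffSpan_eq_zero_imp_kernelOperator_eq_zero μ k hk hf
    rw [kernelOperator, ContinuousLinearMap.comp_apply, ← map_zero (ContinuousMap.toLp 2 μ ℂ)] at h
    -- The image is a continuous function, so it vanishes everywhere; its value at the identity is
    -- ⟨k, f⟩.
    have h2 := congrArg (fun c : C(G, ℂ) => c 1) (ContinuousMap.toLp_injective μ h)
    simpa using h2
  have hall : ∀ k : C(G, ℂ), inner ℂ (ContinuousMap.toLp 2 μ ℂ k) f = 0 := by
    intro k
    have hc : Continuous (starRingEnd ℂ) := Complex.continuous_conj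
    -- Both k + k' and i(k - k') satisfy the Hermitian condition, and together they recover k.
    let k' : C(G, ℂ) := ⟨fun x => (starRingEnd ℂ) (k x⁻¹), by fun_prop⟩
    have h1 := hsym (k + k') (fun x => by simp [k', add_comm])
    have h2 := hsym (Complex.I • (k - k')) (fun x => by simp [k']; ring)
    rw [map_add, inner_add_left] at h1
    rw [map_smul, map_sub, inner_smul_left, inner_sub_left] at h2
    have h3 := (mul_eq_zero.mp h2).resolve_left (by simp)
    linear_combination (h1 + h3) / 2
  have hd : DenseRange (ContinuousMap.toLp (E := ℂ) 2 μ ℂ) :=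
    ContinuousMap.toLp_denseRange ℂ μ ℂ (by simp)
  exact hd.eq_zero_of_inner_right ℂ hall

end PeterWeyl

/-! ### Schur's lemma, orthogonality relations and the Hilbert basis of coefficients -/

section Schur

variable {G : Type*} [Group G] [TopologicalSpace G]

namespace UnitaryIrrep

lemma mat_mul (ξ : UnitaryIrrep G) (g h : G) : ξ.mat (g * h) = ξ.mat g * ξ.mat h := by
  simp [mat]

@[simp]
lemma mat_one (ξ : UnitaryIrrep G) : ξ.mat 1 = 1 := by
  simp [mat]

lemma conjTranspose_mul_mat (ξ : UnitaryIrrep G) (g : G) : (ξ.mat g)ᴴ * ξ.mat g = 1 :=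
  (ξ.hom g).2.1

lemma mat_inv (ξ : UnitaryIrrep G) (g : G) : ξ.mat g⁻¹ = (ξ.mat g)ᴴ := by
  have h : ξ.mat g * ξ.mat g⁻¹ = 1 := by rw [← mat_mul, mul_inv_cancel, mat_one]
  calc ξ.mat g⁻¹ = (ξ.mat g)ᴴ * (ξ.mat g * ξ.mat g⁻¹) := by
        rw [← Matrix.mul_assoc, conjTranspose_mul_mat, Matrix.one_mul]
    _ = (ξ.mat g)ᴴ := by rw [h, Matrix.mul_one]

lemma mat_inv_apply (ξ : UnitaryIrrep G) (g : G) (i j : Fin ξ.dim) :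
    ξ.mat g⁻¹ i j = (starRingEnd ℂ) (ξ.mat g j i) := by
  rw [mat_inv, Matrix.conjTranspose_apply]; rfl

@[simp]
lemma coeff_apply (ξ : UnitaryIrrep G) (i j : Fin ξ.dim) (x : G) :
    ξ.coeff i j x = ξ.mat x i j := rfl

lemma dim_pos (ξ : UnitaryIrrep G) : 0 < ξ.dim := by
  by_contra h
  have h0 : ξ.dim = 0 := by omega
  have : IsEmpty (Fin ξ.dim) := by rw [h0]; infer_instance
  have := ξ.irreducible
  obtain ⟨a, b, hab⟩ := exists_pair_ne (Subrepresentation (matrixRep ξ.hom))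
  exact hab (Subrepresentation.toSubmodule_injective (Subsingleton.elim _ _))

/-- **Schur's lemma**: matrices commuting with an irreducible representation are scalar. -/
lemma exists_eq_smul_one_of_commute (ξ : UnitaryIrrep G) (N : Matrix (Fin ξ.dim) (Fin ξ.dim) ℂ)
    (hN : ∀ h, ξ.mat h * N = N * ξ.mat h) : ∃ c : ℂ, N = c • 1 := by
  have := ξ.irreducible
  let f : Representation.IntertwiningMap (matrixRep ξ.hom) (matrixRep ξ.hom) :=
    LinearMap.intertwiningMap_of_isIntertwiningMap _ _ (Matrix.toLin' N) fun g v => by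
      change Matrix.toLin' N (Matrix.toLin' (ξ.mat g) v) =
        Matrix.toLin' (ξ.mat g) (Matrix.toLin' N v)
      rw [← Matrix.toLin'_mul_apply, ← Matrix.toLin'_mul_apply, hN]
  obtain ⟨c, hc⟩ :=
    (Representation.IsIrreducible.algebraMap_intertwiningMap_bijective_of_isAlgClosed
      (ρ := matrixRep ξ.hom)).2 f
  refine ⟨c, Matrix.toLin'.injective ?_⟩
  ext1 i
  have h2 := fun v => DFunLike.congr_fun hc v
  ext1
  simp only [LinearMap.comp_apply]
  refine ((h2 _).symm).trans ?_
  rw [map_smul, Matrix.toLin'_one]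
  rfl

open scoped ComplexOrder in
/-- **Schur's lemma**: nonzero intertwiners exist only between equivalent representations. -/
lemma eq_zero_or_equivalent_of_intertwines (ξ η : UnitaryIrrep G)
    (M : Matrix (Fin ξ.dim) (Fin η.dim) ℂ) (hM : ∀ h, ξ.mat h * M = M * η.mat h) :
    M = 0 ∨ η.Equivalent ξ := by
  by_cases h0 : M = 0
  · exact Or.inl h0
  right
  have hM' : ∀ h, η.mat h * Mᴴ = Mᴴ * ξ.mat h := fun h => by
    have := congrArg Matrix.conjTranspose (hM h⁻¹)
    rw [Matrix.conjTranspose_mul, Matrix.conjTranspose_mul, mat_inv, mat_inv] at this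
    simpa using this.symm
  obtain ⟨c, hc⟩ := η.exists_eq_smul_one_of_commute (Mᴴ * M) fun h => by
    rw [← Matrix.mul_assoc, hM', Matrix.mul_assoc, hM, Matrix.mul_assoc]
  obtain ⟨c', hc'⟩ := ξ.exists_eq_smul_one_of_commute (M * Mᴴ) fun h => by
    rw [← Matrix.mul_assoc, hM, Matrix.mul_assoc, hM', Matrix.mul_assoc]
  have hcc : c' = c := by
    have h1 : c' • M = c • M := by
      calc c' • M = (M * Mᴴ) * M := by rw [hc']; simp
        _ = M * (Mᴴ * M) := Matrix.mul_assoc _ _ _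
        _ = c • M := by rw [hc]; simp
    by_contra hne
    rw [← sub_eq_zero, ← sub_smul] at h1
    exact h0 ((smul_eq_zero.mp h1).resolve_left (sub_ne_zero.mpr hne))
  have hc0 : c ≠ 0 := by
    rintro rfl
    rw [zero_smul] at hc
    exact h0 (Matrix.conjTranspose_mul_self_eq_zero.mp hc)
  -- A diagonal entry of Mᴴ M exhibits c as the squared norm of a column; hence c > 0, and M/√c is
  -- the required unitary intertwiner.
  let j : Fin η.dim := ⟨0, η.dim_pos⟩
  have hcr : c = ((∑ k, ‖M k j‖ ^ 2 : ℝ) : ℂ) := by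
    have := congrFun (congrFun hc j) j
    simp only [Matrix.mul_apply, Matrix.conjTranspose_apply, Matrix.smul_apply,
      Matrix.one_apply_eq, smul_eq_mul, mul_one] at this
    rw [← this, Complex.ofReal_sum]
    refine Finset.sum_congr rfl fun k _ => ?_
    rw [← starRingEnd_apply, Complex.conj_mul']
    simp
  set r : ℝ := ∑ k, ‖M k j‖ ^ 2
  have hr : 0 ≤ r := Finset.sum_nonneg fun k _ => by positivity
  have hr0 : r ≠ 0 := fun h => hc0 (by rw [hcr, h]; simp)
  have hrr : ((Real.sqrt r : ℝ) : ℂ) * (Real.sqrt r : ℝ) = c := by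
    rw [hcr, ← Complex.ofReal_mul, Real.mul_self_sqrt hr]
  have hs : ((Real.sqrt r : ℝ) : ℂ) ≠ 0 := fun h => hc0 (by rw [← hrr, h]; simp)
  refine ⟨((Real.sqrt r : ℝ) : ℂ)⁻¹ • M, ?_, ?_, fun x => ?_⟩
  · rw [Matrix.conjTranspose_smul, Matrix.smul_mul, Matrix.mul_smul, hc, smul_smul, smul_smul,
      ← hrr]
    have : star ((Real.sqrt r : ℝ) : ℂ)⁻¹ = ((Real.sqrt r : ℝ) : ℂ)⁻¹ := by simp
    rw [this]
    field_simp
    simp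
  · rw [Matrix.conjTranspose_smul, Matrix.smul_mul, Matrix.mul_smul, hc', hcc, smul_smul,
      smul_smul, ← hrr]
    have : star ((Real.sqrt r : ℝ) : ℂ)⁻¹ = ((Real.sqrt r : ℝ) : ℂ)⁻¹ := by simp
    rw [this]
    field_simp
    simp
  · rw [Matrix.smul_mul, Matrix.mul_smul, hM]

end UnitaryIrrep

variable [IsTopologicalGroup G] [CompactSpace G] [MeasurableSpace G] [BorelSpace G]
  (μ : Measure G) [μ.IsHaarMeasure] [IsProbabilityMeasure μ]

lemma integrable_of_continuous {E : Type*} [NormedAddCommGroup E] {f : G → E}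
    (hf : Continuous f) : Integrable f μ :=
  hf.integrable_of_hasCompactSupport (HasCompactSupport.of_compactSpace f)

/-- The matrix `∫ ξ(g) E_{ab} η(g)ᴴ dg`. -/
def averagedMatrix (ξ η : UnitaryIrrep G) (a : Fin ξ.dim) (b : Fin η.dim) :
    Matrix (Fin ξ.dim) (Fin η.dim) ℂ :=
  Matrix.of fun i j => ∫ g, ξ.mat g i a * (starRingEnd ℂ) (η.mat g j b) ∂μ

lemma UnitaryIrrep.continuous_mat_apply (ξ : UnitaryIrrep G) (i j : Fin ξ.dim) :
    Continuous fun g => ξ.mat g i j := (ξ.coeff i j).continuous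

/-- Substituting h⁻¹g for g in the average absorbs ξ(h) on the left and releases η(h) on the right,
by invariance of Haar measure. -/
lemma averagedMatrix_intertwines (ξ η : UnitaryIrrep G) (a : Fin ξ.dim) (b : Fin η.dim) (h : G) :
    ξ.mat h * averagedMatrix μ ξ η a b = averagedMatrix μ ξ η a b * η.mat h := by
  have hc : Continuous (starRingEnd ℂ) := Complex.continuous_conj
  have hξ := ξ.continuous_mat_apply
  have hη := η.continuous_mat_apply
  ext i j
  simp only [Matrix.mul_apply, averagedMatrix, Matrix.of_apply]
  simp_rw [← integral_const_mul, ← integral_mul_const]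
  rw [← integral_finsetSum _ fun k _ => integrable_of_continuous μ (by fun_prop),
    ← integral_finsetSum _ fun k _ => integrable_of_continuous μ (by fun_prop)]
  rw [← integral_mul_left_eq_self _ h⁻¹]
  refine integral_congr_ae (Filter.Eventually.of_forall fun g => ?_)
  simp only
  have h1 : ξ.mat g i a = ∑ k, ξ.mat h i k * ξ.mat (h⁻¹ * g) k a := by
    rw [← Matrix.mul_apply, ← UnitaryIrrep.mat_mul, mul_inv_cancel_left]
  have h2 : (starRingEnd ℂ) (η.mat (h⁻¹ * g) j b) =
      ∑ k, (starRingEnd ℂ) (η.mat g k b) * η.mat h k j := by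
    rw [η.mat_mul, Matrix.mul_apply, map_sum]
    refine Finset.sum_congr rfl fun k _ => ?_
    rw [map_mul, UnitaryIrrep.mat_inv_apply, Complex.conj_conj, mul_comm]
  simp_rw [← mul_assoc]
  rw [← Finset.sum_mul, ← h1, h2, Finset.mul_sum]
  simp_rw [mul_assoc]

lemma integral_mat_mul_conj_eq_zero {ξ η : UnitaryIrrep G} (h : ¬ η.Equivalent ξ)
    (i a : Fin ξ.dim) (j b : Fin η.dim) :
    ∫ g, ξ.mat g i a * (starRingEnd ℂ) (η.mat g j b) ∂μ = 0 := by
  have h0 := (ξ.eq_zero_or_equivalent_of_intertwines η _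
    (averagedMatrix_intertwines μ ξ η a b)).resolve_right h
  exact congrFun (congrFun h0 i) j

lemma integral_mat_mul_conj (ξ : UnitaryIrrep G) (i a j b : Fin ξ.dim) :
    ∫ g, ξ.mat g i a * (starRingEnd ℂ) (ξ.mat g j b) ∂μ =
      if i = j ∧ a = b then (ξ.dim : ℂ)⁻¹ else 0 := by
  have hcs : Continuous (starRingEnd ℂ) := Complex.continuous_conj
  have hξ := ξ.continuous_mat_apply
  obtain ⟨c, hc⟩ := ξ.exists_eq_smul_one_of_commute _ (averagedMatrix_intertwines μ ξ ξ a b)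
  have hd : (ξ.dim : ℂ) ≠ 0 := Nat.cast_ne_zero.mpr ξ.dim_pos.ne'
  -- The trace fixes the Schur scalar: it integrates the inner product of two columns of the unitary
  -- matrix ξ(g), which is constant in g.
  have htr : c * ξ.dim = if a = b then 1 else 0 := by
    have h1 := congrArg Matrix.trace hc
    rw [Matrix.trace_smul, Matrix.trace_one, Fintype.card_fin, smul_eq_mul] at h1
    rw [← h1, Matrix.trace]
    simp only [averagedMatrix, Matrix.diag_apply, Matrix.of_apply]
    rw [← integral_finsetSum _ fun k _ => integrable_of_continuous μ (by fun_prop)]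
    have h2 : ∀ g, ∑ k, ξ.mat g k a * (starRingEnd ℂ) (ξ.mat g k b) = if a = b then 1 else 0 := by
      intro g
      have := congrFun (congrFun (ξ.conjTranspose_mul_mat g) b) a
      rw [Matrix.mul_apply, Matrix.one_apply] at this
      simp only [Matrix.conjTranspose_apply, ← starRingEnd_apply] at this
      simp_rw [mul_comm (ξ.mat g _ a), this, eq_comm]
    simp_rw [h2]
    simp
  have h3 := congrFun (congrFun hc i) j
  simp only [averagedMatrix, Matrix.of_apply, Matrix.smul_apply, Matrix.one_apply,
    smul_eq_mul] at h3
  rw [h3]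
  have hc2 : c = (if a = b then 1 else 0) * (ξ.dim : ℂ)⁻¹ := by rw [← htr]; field_simp
  rw [hc2]
  by_cases hij : i = j <;> by_cases hab : a = b <;> simp [hij, hab]

variable (G) in
/-- Index set of the matrix coefficients of representatives of the unitary dual. -/
abbrev CoeffIndex : Type _ := Σ ξ : UnitaryDual G, Fin ξ.rep.dim × Fin ξ.rep.dim

/-- The matrix coefficient `ξ_{ij}` as an element of `L²(G)`. -/
def UnitaryIrrep.lpCoeff (ξ : UnitaryIrrep G) (i j : Fin ξ.dim) : Lp ℂ 2 μ :=
  ContinuousMap.toLp 2 μ ℂ (ξ.coeff i j)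

lemma inner_lpCoeff_self (ξ : UnitaryIrrep G) (i a j b : Fin ξ.dim) :
    inner ℂ (ξ.lpCoeff μ j b) (ξ.lpCoeff μ i a) =
      if i = j ∧ a = b then (ξ.dim : ℂ)⁻¹ else 0 := by
  rw [UnitaryIrrep.lpCoeff, UnitaryIrrep.lpCoeff, ContinuousMap.inner_toLp]
  exact integral_mat_mul_conj μ ξ i a j b

lemma inner_lpCoeff_of_not_equivalent {ξ η : UnitaryIrrep G} (h : ¬ η.Equivalent ξ)
    (i a : Fin ξ.dim) (j b : Fin η.dim) :
    inner ℂ (η.lpCoeff μ j b) (ξ.lpCoeff μ i a) = 0 := by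
  rw [UnitaryIrrep.lpCoeff, UnitaryIrrep.lpCoeff, ContinuousMap.inner_toLp]
  exact integral_mat_mul_conj_eq_zero μ h i a j b

lemma UnitaryDual.not_equivalent_rep {ξ η : UnitaryDual G} (h : η ≠ ξ) :
    ¬ η.rep.Equivalent ξ.rep := fun he => h (by
  have h2 := Quotient.sound (s := UnitaryIrrep.setoid G) he
  exact (Quotient.out_eq (s := UnitaryIrrep.setoid G) η).symm.trans
    (h2.trans (Quotient.out_eq (s := UnitaryIrrep.setoid G) ξ)))

/-- The normalized matrix coefficient `√d_ξ ξ_{ij}`. -/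
def normalizedCoeff (k : CoeffIndex G) : Lp ℂ 2 μ :=
  ((Real.sqrt k.1.rep.dim : ℝ) : ℂ) • k.1.rep.lpCoeff μ k.2.1 k.2.2

lemma orthonormal_normalizedCoeff : Orthonormal ℂ (normalizedCoeff (G := G) μ) := by
  classical
  rw [orthonormal_iff_ite]
  rintro ⟨η, j, b⟩ ⟨ξ, i, a⟩
  simp only [normalizedCoeff, inner_smul_left, inner_smul_right]
  by_cases h : η = ξ
  · subst h
    rw [inner_lpCoeff_self]
    have hd : (η.rep.dim : ℂ) ≠ 0 := Nat.cast_ne_zero.mpr η.rep.dim_pos.ne'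
    have hs : ((Real.sqrt η.rep.dim : ℝ) : ℂ) * (Real.sqrt η.rep.dim : ℝ) = η.rep.dim := by
      rw [← Complex.ofReal_mul, Real.mul_self_sqrt (by positivity)]; simp
    by_cases hij : j = i ∧ b = a
    · obtain ⟨rfl, rfl⟩ := hij
      simp only [and_self, if_true, Complex.conj_ofReal]
      rw [mul_left_comm, ← mul_assoc, hs, mul_inv_cancel₀ hd]
    · rw [if_neg (fun h => hij ⟨h.1.symm, h.2.symm⟩), if_neg (fun h => hij (by simpa using h))]
      simp
  · rw [inner_lpCoeff_of_not_equivalent μ (UnitaryDual.not_equivalent_rep h),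
      if_neg (fun h' => h (congrArg Sigma.fst h'))]
    simp

lemma coeff_mem_span_rep (ξ : UnitaryIrrep G) (i j : Fin ξ.dim) :
    ∃ (η : UnitaryDual G) (c : Fin η.rep.dim → Fin η.rep.dim → ℂ),
      ξ.coeff i j = ∑ k, ∑ l, c k l • η.rep.coeff k l := by
  let η : UnitaryDual G := Quotient.mk (UnitaryIrrep.setoid G) ξ
  obtain ⟨T, h1, h2, h3⟩ : ξ.Equivalent η.rep :=
    (UnitaryIrrep.setoid G).symm (Quotient.mk_out (s := UnitaryIrrep.setoid G) ξ)
  refine ⟨η, fun k l => Tᴴ i k * T l j, ?_⟩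
  ext x
  have h4 : ξ.mat x = Tᴴ * η.rep.mat x * T := by
    rw [Matrix.mul_assoc, ← h3, ← Matrix.mul_assoc, h1, Matrix.one_mul]
  simp only [UnitaryIrrep.coeff_apply, ContinuousMap.sum_apply, ContinuousMap.smul_apply,
    smul_eq_mul]
  rw [h4, Matrix.mul_apply]
  simp_rw [Matrix.mul_apply, Finset.sum_mul]
  rw [Finset.sum_comm]
  refine Finset.sum_congr rfl fun k _ => Finset.sum_congr rfl fun l _ => by ring

lemma eq_zero_of_inner_lpCoeff_eq_zero {f : Lp ℂ 2 μ}
    (hf : ∀ (ξ : UnitaryDual G) (i j), inner ℂ (ξ.rep.lpCoeff μ i j) f = 0) : f = 0 := by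
  have := isMulRightInvariant_of_isHaarMeasure μ
  refine eq_zero_of_inner_coeffSpan_eq_zero μ fun c hc => ?_
  induction hc using Submodule.span_induction with
  | mem c hc =>
    obtain ⟨ξ, i, j, rfl⟩ := hc
    obtain ⟨η, c, h⟩ := coeff_mem_span_rep ξ i j
    rw [h, map_sum, sum_inner]
    refine Finset.sum_eq_zero fun k _ => ?_
    rw [map_sum, sum_inner]
    refine Finset.sum_eq_zero fun l _ => ?_
    rw [map_smul, inner_smul_left]
    exact mul_eq_zero_of_right _ (hf η k l)
  | zero => simp
  | add c c' _ _ h h' => rw [map_add, inner_add_left, h, h', add_zero]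
  | smul a c _ h => rw [map_smul, inner_smul_left, h, mul_zero]

/-- The Hilbert basis of normalized matrix coefficients. -/
def coeffBasis : HilbertBasis (CoeffIndex G) ℂ (Lp ℂ 2 μ) :=
  HilbertBasis.mkOfOrthogonalEqBot (orthonormal_normalizedCoeff μ) (by
    rw [Submodule.eq_bot_iff]
    intro f hf
    refine eq_zero_of_inner_lpCoeff_eq_zero μ fun ξ i j => ?_
    have h := hf _ (Submodule.subset_span ⟨⟨ξ, i, j⟩, rfl⟩)
    rw [normalizedCoeff, inner_smul_left] at h
    refine (mul_eq_zero.mp h).resolve_left ?_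
    have : (ξ.rep.dim : ℝ) ≠ 0 := Nat.cast_ne_zero.mpr ξ.rep.dim_pos.ne'
    simpa [Real.sqrt_eq_zero'] using ξ.rep.dim_pos.ne')

lemma coeffBasis_apply (k : CoeffIndex G) : coeffBasis μ k = normalizedCoeff μ k := by
  rw [coeffBasis, HilbertBasis.coe_mkOfOrthogonalEqBot]

end Schur

/-! ### Left multipliers act through their symbol -/

section Multiplier

variable {G : Type*} [Group G] [TopologicalSpace G] [IsTopologicalGroup G] [CompactSpace G]
  [MeasurableSpace G] [BorelSpace G] (μ : Measure G) [μ.IsHaarMeasure] [IsProbabilityMeasure μ]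

lemma continuous_leftTranslate (f : Lp ℂ 2 μ) : Continuous fun g => leftTranslate μ g f := by
  let F : C(G, C(G, G)) := ContinuousMap.curry ⟨fun p : G × G => p.1⁻¹ * p.2, by fun_prop⟩
  exact Continuous.compMeasurePreservingLp (f := fun _ : G => f) continuous_const F.continuous
    (fun g => measurePreserving_mul_left μ g⁻¹) (by simp)

lemma inner_leftTranslate_leftTranslate (g : G) (u v : Lp ℂ 2 μ) :
    inner ℂ (leftTranslate μ g u) (leftTranslate μ g v) = inner ℂ u v :=
  (Lp.compMeasurePreservingₗᵢ ℂ (fun x => g⁻¹ * x)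
    (measurePreserving_mul_left μ g⁻¹)).inner_map_map u v

lemma leftTranslate_leftTranslate_inv (g : G) (u : Lp ℂ 2 μ) :
    leftTranslate μ g (leftTranslate μ g⁻¹ u) = u := by
  have h := Lp.compMeasurePreserving_comp_apply u (measurePreserving_mul_left μ g⁻¹⁻¹)
      (measurePreserving_mul_left μ g⁻¹)
  refine h.symm.trans (Lp.ext ?_)
  refine (Lp.coeFn_compMeasurePreserving u _).trans (Filter.Eventually.of_forall fun x => ?_)
  simp

lemma inner_leftTranslate (g : G) (u v : Lp ℂ 2 μ) :
    inner ℂ u (leftTranslate μ g v) = inner ℂ (leftTranslate μ g⁻¹ u) v := by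
  rw [← inner_leftTranslate_leftTranslate μ g (leftTranslate μ g⁻¹ u),
    leftTranslate_leftTranslate_inv]

lemma leftTranslate_toLp (g : G) (f : C(G, ℂ)) :
    leftTranslate μ g (ContinuousMap.toLp 2 μ ℂ f) =
      ContinuousMap.toLp 2 μ ℂ (f.comp ⟨fun x => g⁻¹ * x, continuous_const_mul g⁻¹⟩) := by
  refine Lp.ext ?_
  refine (Lp.coeFn_compMeasurePreserving _ (measurePreserving_mul_left μ g⁻¹)).trans ?_
  refine ((measurePreserving_mul_left μ g⁻¹).quasiMeasurePreserving.ae_eq_comp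
    (ContinuousMap.coeFn_toLp μ f)).trans ?_
  exact (ContinuousMap.coeFn_toLp (E := ℂ) (𝕜 := ℂ) (p := 2) μ
    (f.comp ⟨fun x => g⁻¹ * x, continuous_const_mul g⁻¹⟩)).symm

lemma leftTranslate_inv_lpCoeff (ζ : UnitaryIrrep G) (g : G) (a b : Fin ζ.dim) :
    leftTranslate μ g⁻¹ (ζ.lpCoeff μ a b) = ∑ c, ζ.mat g a c • ζ.lpCoeff μ c b := by
  simp_rw [UnitaryIrrep.lpCoeff, leftTranslate_toLp, ← map_smul, ← map_sum]
  congr 1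
  ext x
  simp [UnitaryIrrep.mat_mul, Matrix.mul_apply]

lemma integrable_smul_leftTranslate (φ : C(G, ℂ)) (f : Lp ℂ 2 μ) :
    Integrable (fun g => φ g • leftTranslate μ g f) μ :=
  integrable_of_continuous μ (φ.continuous.smul (continuous_leftTranslate μ f))

/-- Convolution with a matrix coefficient is a combination of matrix coefficients. -/
lemma integral_coeff_smul_leftTranslate (ξ : UnitaryDual G) (k l : Fin ξ.rep.dim)
    (f : Lp ℂ 2 μ) :
    ∫ g, ξ.rep.coeff k l g • leftTranslate μ g f ∂μ =
      ∑ m, inner ℂ (ξ.rep.lpCoeff μ l m) f • ξ.rep.lpCoeff μ k m := by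
  rw [← sub_eq_zero]
  refine eq_zero_of_inner_lpCoeff_eq_zero μ fun ζ a b => ?_
  rw [inner_sub_right, sub_eq_zero]
  have hcs : Continuous (starRingEnd ℂ) := Complex.continuous_conj
  have hξ := ξ.rep.continuous_mat_apply
  have hζ := ζ.rep.continuous_mat_apply
  have h1 : inner ℂ (ζ.rep.lpCoeff μ a b) (∫ g, ξ.rep.coeff k l g • leftTranslate μ g f ∂μ) =
      ∑ c, (∫ g, ξ.rep.mat g k l * (starRingEnd ℂ) (ζ.rep.mat g a c) ∂μ) *
        inner ℂ (ζ.rep.lpCoeff μ c b) f := by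
    rw [← integral_inner (integrable_smul_leftTranslate μ _ f)]
    simp_rw [← integral_mul_const]
    rw [← integral_finsetSum _ fun c _ => integrable_of_continuous μ (by fun_prop)]
    refine integral_congr_ae (Filter.Eventually.of_forall fun g => ?_)
    simp only [inner_smul_right, UnitaryIrrep.coeff_apply]
    rw [inner_leftTranslate, leftTranslate_inv_lpCoeff, sum_inner, Finset.mul_sum]
    refine Finset.sum_congr rfl fun c _ => ?_
    rw [inner_smul_left, mul_assoc]
  rw [h1, inner_sum]
  simp_rw [inner_smul_right]
  by_cases h : ζ = ξ
  · subst h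
    simp_rw [integral_mat_mul_conj, inner_lpCoeff_self]
    by_cases hk : k = a
    · subst hk
      simp [mul_comm]
    · simp [hk]
  · have hne := UnitaryDual.not_equivalent_rep h
    simp_rw [integral_mat_mul_conj_eq_zero μ hne, inner_lpCoeff_of_not_equivalent μ hne]
    simp

variable {μ} {A : Lp ℂ 2 μ →ₗ.[ℂ] Lp ℂ 2 μ}

/-- The graph is a closed subspace containing every translate of (f, Af); Bochner averages of points
of a closed convex set stay in it. -/
lemma IsLeftFourierMultiplier.integral_mem_graph (hA : IsLeftFourierMultiplier μ A)
    (φ : C(G, ℂ)) (f : A.domain) :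
    (∫ g, φ g • leftTranslate μ g f ∂μ, ∫ g, φ g • leftTranslate μ g (A f) ∂μ) ∈ A.graph := by
  rw [← integral_pair (integrable_smul_leftTranslate μ φ f)
    (integrable_smul_leftTranslate μ φ (A f))]
  have hconv : Convex ℝ (A.graph : Set (Lp ℂ 2 μ × Lp ℂ 2 μ)) :=
    (A.graph.restrictScalars ℝ).convex
  refine hconv.integral_mem hA.isClosed (Filter.Eventually.of_forall fun g => ?_)
    ((integrable_smul_leftTranslate μ φ f).prodMk (integrable_smul_leftTranslate μ φ (A f)))
  obtain ⟨h, hA'⟩ := hA.left_invariant g f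
  have : (leftTranslate μ g f, leftTranslate μ g (A f)) ∈ A.graph :=
    (LinearPMap.mem_graph_iff _).mpr ⟨⟨_, h⟩, rfl, hA'⟩
  exact A.graph.smul_mem (φ g) this

lemma IsLeftFourierMultiplier.sum_mem_graph (hA : IsLeftFourierMultiplier μ A)
    (ξ : UnitaryDual G) (k l : Fin ξ.rep.dim) (f : A.domain) :
    (∑ m, inner ℂ (ξ.rep.lpCoeff μ l m) (f : Lp ℂ 2 μ) • ξ.rep.lpCoeff μ k m,
      ∑ m, inner ℂ (ξ.rep.lpCoeff μ l m) (A f) • ξ.rep.lpCoeff μ k m) ∈ A.graph := by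
  rw [← integral_coeff_smul_leftTranslate, ← integral_coeff_smul_leftTranslate]
  exact hA.integral_mem_graph _ f

lemma inner_lpCoeff_sum (ξ : UnitaryIrrep G) (k n : Fin ξ.dim) (c : Fin ξ.dim → ℂ) :
    inner ℂ (ξ.lpCoeff μ k n) (∑ m, c m • ξ.lpCoeff μ k m) = c n * (ξ.dim : ℂ)⁻¹ := by
  rw [inner_sum]
  simp_rw [inner_smul_right, inner_lpCoeff_self]
  simp

/-- The coefficient map onto a finite-dimensional space sends the dense domain to a dense subspace,
which is closed and hence everything. Coefficients can therefore be prescribed exactly, not just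
approximately. -/
lemma exists_mem_domain_inner_lpCoeff (hA : Dense (A.domain : Set (Lp ℂ 2 μ)))
    (ξ : UnitaryIrrep G) (B : Fin ξ.dim × Fin ξ.dim → ℂ) :
    ∃ f : A.domain, ∀ l m, inner ℂ (ξ.lpCoeff μ l m) (f : Lp ℂ 2 μ) = B (l, m) := by
  let Φ : Lp ℂ 2 μ →L[ℂ] (Fin ξ.dim × Fin ξ.dim → ℂ) :=
    ContinuousLinearMap.pi fun lm => innerSL ℂ (ξ.lpCoeff μ lm.1 lm.2)
  have hΦ : ∀ f lm, Φ f lm = inner ℂ (ξ.lpCoeff μ lm.1 lm.2) f := fun f lm => rfl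
  have hd : (ξ.dim : ℂ) ≠ 0 := Nat.cast_ne_zero.mpr ξ.dim_pos.ne'
  have hsurj : Function.Surjective Φ := fun B => by
    refine ⟨∑ i, ∑ a, ((ξ.dim : ℂ) * B (i, a)) • ξ.lpCoeff μ i a, ?_⟩
    ext ⟨l, m⟩
    rw [hΦ]
    simp_rw [inner_sum, inner_smul_right, inner_lpCoeff_self]
    rw [Finset.sum_eq_single l (fun i _ hi => by simp [hi]) (by simp),
      Finset.sum_eq_single m (fun a _ ha => by simp [ha]) (by simp)]
    simp only [and_self, if_true]
    field_simp
  have hdense : Dense (Φ '' (A.domain : Set (Lp ℂ 2 μ))) :=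
    hsurj.denseRange.dense_image Φ.continuous hA
  have hcl := Submodule.closed_of_finiteDimensional (A.domain.map Φ.toLinearMap)
  have hB : B ∈ A.domain.map Φ.toLinearMap := by
    have h : closure (Φ '' (A.domain : Set (Lp ℂ 2 μ))) = Φ '' A.domain := hcl.closure_eq
    exact (h.symm.trans hdense.closure_eq).ge (Set.mem_univ B)
  obtain ⟨f, hf, rfl⟩ := hB
  exact ⟨⟨f, hf⟩, fun l m => (hΦ f (l, m)).symm⟩

/-- Convolving ξ_{kl} with f gives ∑_m ⟨ξ_{lm}, f⟩ ξ_{km}. For f in the domain with the identity as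
its coefficient matrix this is ξ_{kl} itself, so matrix coefficients lie in the domain. A single f
serves all k and l, so the matrix does not depend on the row k. -/
lemma IsLeftFourierMultiplier.exists_matrix (hA : IsLeftFourierMultiplier μ A)
    (ξ : UnitaryDual G) : ∃ S : Matrix (Fin ξ.rep.dim) (Fin ξ.rep.dim) ℂ, ∀ k l,
      (ξ.rep.lpCoeff μ k l, ∑ m, S m l • ξ.rep.lpCoeff μ k m) ∈ A.graph := by
  obtain ⟨f, hf⟩ := exists_mem_domain_inner_lpCoeff hA.dense_domain ξ.rep
    fun lm => if lm.1 = lm.2 then 1 else 0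
  refine ⟨Matrix.of fun m l => inner ℂ (ξ.rep.lpCoeff μ l m) (A f), fun k l => ?_⟩
  convert hA.sum_mem_graph ξ k l f using 2
  · simp [hf]
  · rfl

lemma applyCoeff_eq_of_mem_graph {ξ : UnitaryIrrep G} {i j : Fin ξ.dim} {h : Lp ℂ 2 μ}
    (hh : (ξ.lpCoeff μ i j, h) ∈ A.graph) : applyCoeff μ A ξ i j = h := by
  obtain ⟨y, hy, hAy⟩ := (LinearPMap.mem_graph_iff _).mp hh
  change (y : Lp ℂ 2 μ) = ξ.lpCoeff μ i j at hy
  have hmem : ContinuousMap.toLp 2 μ ℂ (ξ.coeff i j) ∈ A.domain := by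
    change ξ.lpCoeff μ i j ∈ _
    exact hy ▸ y.2
  rw [applyCoeff, dif_pos hmem]
  exact (congrArg A (Subtype.ext hy.symm)).trans hAy

/-- The hypothesis reads Aξ = ξS, so ξ(x)*(Aξ)(x) = S for almost every x, and averaging changes
nothing. -/
lemma symbol_eq_of_mem_graph {ξ : UnitaryIrrep G} {S : Matrix (Fin ξ.dim) (Fin ξ.dim) ℂ}
    (hS : ∀ k l, (ξ.lpCoeff μ k l, ∑ m, S m l • ξ.lpCoeff μ k m) ∈ A.graph) :
    symbol μ A ξ = S := by
  ext k j
  have h1 : ∀ i, applyCoeff μ A ξ i j =ᵐ[μ] fun x => ∑ m, S m j * ξ.mat x i m := by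
    intro i
    rw [applyCoeff_eq_of_mem_graph (hS i j)]
    simp_rw [UnitaryIrrep.lpCoeff, ← map_smul, ← map_sum]
    refine (ContinuousMap.coeFn_toLp μ _).trans (Filter.Eventually.of_forall fun x => ?_)
    simp
  have h2 : (fun x => ∑ i, (ξ.mat x)ᴴ k i * applyCoeff μ A ξ i j x) =ᵐ[μ] fun _ => S k j := by
    filter_upwards [ae_all_iff.mpr h1] with x hx
    have h3 : ∀ i, ∑ m, S m j * ξ.mat x i m = (ξ.mat x * S) i j := fun i => by
      rw [Matrix.mul_apply]
      exact Finset.sum_congr rfl fun m _ => mul_comm _ _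
    simp_rw [hx, h3]
    rw [← Matrix.mul_apply (M := (ξ.mat x)ᴴ), ← Matrix.mul_assoc, ξ.conjTranspose_mul_mat, Matrix.one_mul]
  rw [symbol, Matrix.of_apply, integral_congr_ae h2]
  simp

/-- A left Fourier multiplier acts on Fourier coefficients through its symbol. -/
theorem IsLeftFourierMultiplier.inner_lpCoeff_apply (hA : IsLeftFourierMultiplier μ A)
    (f : A.domain) (ξ : UnitaryDual G) (l n : Fin ξ.rep.dim) :
    inner ℂ (ξ.rep.lpCoeff μ l n) (A f) =
      ∑ m, symbol μ A ξ.rep n m * inner ℂ (ξ.rep.lpCoeff μ l m) (f : Lp ℂ 2 μ) := by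
  obtain ⟨S, hS⟩ := hA.exists_matrix ξ
  rw [symbol_eq_of_mem_graph hS]
  have hd : (ξ.rep.dim : ℂ)⁻¹ ≠ 0 := inv_ne_zero (Nat.cast_ne_zero.mpr ξ.rep.dim_pos.ne')
  have h1 := hA.sum_mem_graph ξ l l f
  have h2 : (∑ m, inner ℂ (ξ.rep.lpCoeff μ l m) (f : Lp ℂ 2 μ) • ξ.rep.lpCoeff μ l m,
      ∑ m, inner ℂ (ξ.rep.lpCoeff μ l m) (f : Lp ℂ 2 μ) •
        ∑ n, S n m • ξ.rep.lpCoeff μ l n) ∈ A.graph := by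
    have := A.graph.sum_mem (t := Finset.univ) fun m _ =>
      A.graph.smul_mem (inner ℂ (ξ.rep.lpCoeff μ l m) (f : Lp ℂ 2 μ)) (hS l m)
    convert this using 1
    rw [Prod.ext_iff]
    simp [Prod.fst_sum, Prod.snd_sum]
  -- Two graph points over the same function: one obtained by averaging translates of f, the other
  -- by linearity from the action on matrix coefficients.
  have h3 := LinearPMap.mem_graph_snd_inj' _ h1 h2 rfl
  have h4 : ∑ m, inner ℂ (ξ.rep.lpCoeff μ l m) (f : Lp ℂ 2 μ) •
        ∑ n, S n m • ξ.rep.lpCoeff μ l n =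
      ∑ n, (∑ m, S n m * inner ℂ (ξ.rep.lpCoeff μ l m) (f : Lp ℂ 2 μ)) •
        ξ.rep.lpCoeff μ l n := by
    simp_rw [Finset.smul_sum, Finset.sum_smul, smul_smul]
    rw [Finset.sum_comm]
    simp_rw [mul_comm]
  have h5 := congrArg (inner ℂ (ξ.rep.lpCoeff μ l n)) (h3.trans h4)
  rw [inner_lpCoeff_sum, inner_lpCoeff_sum] at h5
  exact mul_right_cancel₀ hd h5

end Multiplier

/-! ### Dyadic geometric sums -/

section Paley

lemma two_rpow_add (x y : ℝ) : (2 : ℝ≥0∞) ^ (x + y) = 2 ^ x * 2 ^ y :=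
  ENNReal.rpow_add _ _ two_ne_zero ENNReal.ofNat_ne_top

lemma tsum_two_rpow_le_of_pos {β : ℝ} (hβ : 0 < β) (x : ℝ) :
    ∑' k : ℤ, (if (k : ℝ) ≤ x then (2 : ℝ≥0∞) ^ (k * β) else 0) ≤
      (1 - (2 : ℝ≥0∞) ^ (-β))⁻¹ * 2 ^ (x * β) := by
  have hinj : Function.Injective fun n : ℕ => ⌊x⌋ - (n : ℤ) := fun a b h => by
    have : ⌊x⌋ - (a : ℤ) = ⌊x⌋ - b := h
    omega
  rw [← hinj.tsum_eq]
  · rw [← ENNReal.tsum_geometric, ← ENNReal.tsum_mul_right]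
    refine ENNReal.tsum_le_tsum fun n => ?_
    split_ifs
    · rw [← ENNReal.rpow_natCast, ← ENNReal.rpow_mul, ← two_rpow_add]
      refine ENNReal.rpow_le_rpow_of_exponent_le one_le_two ?_
      push_cast
      nlinarith [Int.floor_le x]
    · exact zero_le
  · intro k hk
    have hkx : (k : ℝ) ≤ x := by
      by_contra h
      simp [h] at hk
    have := Int.le_floor.mpr hkx
    exact ⟨(⌊x⌋ - k).toNat, by simp only; omega⟩

lemma tsum_two_rpow_neg_le_of_pos {β : ℝ} (hβ : 0 < β) (x : ℝ) :
    ∑' k : ℤ, (if x ≤ (k : ℝ) then (2 : ℝ≥0∞) ^ (-(k * β)) else 0) ≤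
      (1 - (2 : ℝ≥0∞) ^ (-β))⁻¹ * 2 ^ (-(x * β)) := by
  have h := tsum_two_rpow_le_of_pos hβ (-x)
  rw [← (Equiv.neg ℤ).tsum_eq] at h
  simpa [neg_mul] using h

/-- The term k = ⌊log₂ u⌋ alone suffices, rounding costing 2^β. The full sum over levels is kept so
that it can be exchanged with the sum over indices. -/
lemma rpow_le_two_rpow_mul_tsum {β : ℝ} (hβ : 0 < β) (u : ℝ≥0) :
    (u : ℝ≥0∞) ^ β ≤ 2 ^ β *
      ∑' k : ℤ, (if (2 : ℝ≥0) ^ (k : ℝ) ≤ u then (2 : ℝ≥0∞) ^ (k * β) else 0) := by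
  rcases eq_or_ne u 0 with rfl | hu
  · simp [ENNReal.zero_rpow_of_pos hβ]
  have hu' : (0 : ℝ) < u := by positivity
  have huL : (u : ℝ) = 2 ^ (Real.logb 2 u) := (Real.rpow_logb two_pos (by norm_num) hu').symm
  have h1 : (2 : ℝ≥0) ^ ((⌊Real.logb 2 u⌋ : ℤ) : ℝ) ≤ u := by
    rw [← NNReal.coe_le_coe, NNReal.coe_rpow]
    refine le_of_le_of_eq ?_ huL.symm
    exact Real.rpow_le_rpow_of_exponent_le one_le_two (Int.floor_le _)
  have h2 : (u : ℝ≥0∞) = 2 ^ (Real.logb 2 u) := by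
    have : u = 2 ^ (Real.logb 2 u) := by
      rw [← NNReal.coe_inj, NNReal.coe_rpow]; exact huL
    nth_rewrite 1 [this]
    rw [ENNReal.coe_rpow_of_ne_zero two_ne_zero]
    simp
  refine le_trans ?_ (mul_le_mul_right (ENNReal.le_tsum ⌊Real.logb 2 u⌋) _)
  rw [if_pos h1, h2, ← ENNReal.rpow_mul, ← two_rpow_add]
  refine ENNReal.rpow_le_rpow_of_exponent_le one_le_two ?_
  nlinarith [Int.lt_floor_add_one (Real.logb 2 u)]

lemma one_sub_two_rpow_neg_inv_ne_top {β : ℝ} (hβ : 0 < β) :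
    (1 - (2 : ℝ≥0∞) ^ (-β))⁻¹ ≠ ⊤ := by
  rw [ENNReal.inv_ne_top, ← pos_iff_ne_zero, tsub_pos_iff_lt]
  exact ENNReal.rpow_lt_one_of_one_lt_of_neg ENNReal.one_lt_two (by linarith)

lemma enorm_eq_two_rpow {z : ℂ} (hz : z ≠ 0) : ‖z‖ₑ = 2 ^ (Real.logb 2 ‖z‖) := by
  have h : ‖z‖₊ = 2 ^ (Real.logb 2 ‖z‖) := by
    rw [← NNReal.coe_inj, NNReal.coe_rpow]
    exact (Real.rpow_logb two_pos (by norm_num) (norm_pos_iff.mpr hz)).symm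
  rw [enorm_eq_nnnorm, h, ENNReal.coe_rpow_of_ne_zero two_ne_zero]
  simp

lemma two_rpow_le_two_rpow_iff {x y : ℝ} : (2 : ℝ≥0∞) ^ x ≤ 2 ^ y ↔ x ≤ y := by
  constructor
  · intro h
    by_contra! hlt
    exact absurd h (not_le.mpr (ENNReal.rpow_lt_rpow_of_exponent_lt ENNReal.one_lt_two
      ENNReal.ofNat_ne_top hlt))
  · exact ENNReal.rpow_le_rpow_of_exponent_le one_le_two

/-- For fixed z the cutoff says k ≤ -p log₂|z|. The geometric series is comparable to its value at
that endpoint, and the powers of |z| combine to |z|^p. The high truncation sums over the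
complementary k. -/
lemma tsum_low_truncation_le {p : ℝ} (hp : 0 < p) (hp2 : p < 2) (z : ℂ) :
    ∑' k : ℤ, (2 : ℝ≥0∞) ^ (k * (2 / p - 1)) *
      (if ‖z‖ₑ ≤ 2 ^ (-(k / p)) then ‖z‖ₑ ^ (2 : ℝ) else 0) ≤
      (1 - (2 : ℝ≥0∞) ^ (-(2 / p - 1)))⁻¹ * ‖z‖ₑ ^ p := by
  rcases eq_or_ne z 0 with rfl | hz
  · simp
  have hβ : 0 < 2 / p - 1 := by rw [sub_pos, lt_div_iff₀ hp]; linarith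
  set L := Real.logb 2 ‖z‖
  rw [enorm_eq_two_rpow hz]
  have h := mul_le_mul_left (tsum_two_rpow_le_of_pos hβ (-(p * L))) ((2 : ℝ≥0∞) ^ (2 * L))
  rw [← ENNReal.tsum_mul_right, mul_assoc, ← two_rpow_add] at h
  refine le_of_eq_of_le (tsum_congr fun k => ?_) (h.trans_eq ?_)
  · simp only [two_rpow_le_two_rpow_iff]
    rw [← ENNReal.rpow_mul, mul_comm L 2]
    have : (Real.logb 2 ‖z‖ ≤ -(k / p)) ↔ ((k : ℝ) ≤ -(p * L)) := by
      change L ≤ -(k / p) ↔ _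
      rw [le_neg, div_le_iff₀ hp]
      constructor <;> intro h <;> linarith
    simp only [this]
    split_ifs <;> simp
  · rw [← ENNReal.rpow_mul]
    congr 2
    field_simp
    ring

lemma tsum_high_truncation_le {p : ℝ} (hp : 1 < p) (z : ℂ) :
    ∑' k : ℤ, (2 : ℝ≥0∞) ^ (-(k * (1 - 1 / p))) *
      (if ‖z‖ₑ ≤ 2 ^ (-(k / p)) then 0 else ‖z‖ₑ) ≤
      (1 - (2 : ℝ≥0∞) ^ (-(1 - 1 / p)))⁻¹ * ‖z‖ₑ ^ p := by
  rcases eq_or_ne z 0 with rfl | hz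
  · simp
  have hp0 : 0 < p := by linarith
  have hβ : 0 < 1 - 1 / p := by rw [sub_pos, div_lt_one hp0]; exact hp
  set L := Real.logb 2 ‖z‖
  rw [enorm_eq_two_rpow hz]
  have h := mul_le_mul_left (tsum_two_rpow_neg_le_of_pos hβ (-(p * L))) ((2 : ℝ≥0∞) ^ L)
  rw [← ENNReal.tsum_mul_right, mul_assoc, ← two_rpow_add] at h
  refine le_trans (ENNReal.tsum_le_tsum fun k => ?_) (h.trans_eq ?_)
  · simp only [two_rpow_le_two_rpow_iff]
    have : (Real.logb 2 ‖z‖ ≤ -(k / p)) ↔ ((k : ℝ) ≤ -(p * L)) := by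
      change L ≤ -(k / p) ↔ _
      rw [le_neg, div_le_iff₀ hp0]
      constructor <;> intro h <;> linarith
    simp only [this]
    by_cases hk : (k : ℝ) ≤ -(p * L)
    · simp [hk]
    · simp [hk, (not_le.mp hk).le, L]
  · rw [← ENNReal.rpow_mul]
    congr 2
    field_simp
    ring

end Paley

/-! ### Paley's inequality by truncation -/

section PaleyAbstract

/-- A family of square masses `a f i` on functions, with subadditivity up to a factor and
`L²`- and `L¹`-bounds, the latter with weights `D i`. -/
structure IsSquareMass {X I : Type*} [MeasurableSpace X] (μ : Measure X) (D : I → ℝ≥0∞)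
    (a : (X → ℂ) → I → ℝ≥0∞) : Prop where
  add_le : ∀ {g h : X → ℂ}, MemLp g 2 μ → MemLp h 2 μ → ∀ i, a (g + h) i ≤ 2 * (a g i + a h i)
  tsum_le : ∀ {g : X → ℂ}, MemLp g 2 μ → ∑' i, a g i ≤ ∫⁻ x, ‖g x‖ₑ ^ (2 : ℝ) ∂μ
  le_mul : ∀ {g : X → ℂ}, MemLp g 2 μ → ∀ i, a g i ≤ D i * (∫⁻ x, ‖g x‖ₑ ∂μ) ^ 2

section Truncation

variable {X I : Type*} [MeasurableSpace X] {μ : Measure X} {D : I → ℝ≥0∞}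
  {a : (X → ℂ) → I → ℝ≥0∞}

/-- The set where `|f| ≤ 2^{-k/p}`. -/
def lowSet (f : X → ℂ) (p : ℝ) (k : ℤ) : Set X := {x | ‖f x‖ₑ ≤ 2 ^ (-(k / p))}

lemma measurableSet_lowSet {f : X → ℂ} (hf : StronglyMeasurable f) (p : ℝ) (k : ℤ) :
    MeasurableSet (lowSet f p k) :=
  measurableSet_le hf.measurable.enorm measurable_const

open Classical in
-- The L² bound handles each low part without restricting the indices; Tonelli then reduces the sum
-- over k to `tsum_low_truncation_le`.
lemma low_sum_le {p : ℝ} (hp : 0 < p) (hp2 : p < 2) (ha : IsSquareMass μ D a) {f : X → ℂ}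
    (hfm : StronglyMeasurable f) (hf : MemLp f 2 μ) (hfp : ∫⁻ x, ‖f x‖ₑ ^ p ∂μ ≤ 1) :
    ∑' k : ℤ, (2 : ℝ≥0∞) ^ (k * (2 / p - 1)) * ∑' i, a ((lowSet f p k).indicator f) i ≤
      (1 - (2 : ℝ≥0∞) ^ (-(2 / p - 1)))⁻¹ := by
  have hm := fun k => measurableSet_lowSet hfm p k
  have hmeas : ∀ k : ℤ, Measurable fun x =>
      if ‖f x‖ₑ ≤ 2 ^ (-(k / p)) then ‖f x‖ₑ ^ (2 : ℝ) else 0 := fun k =>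
    Measurable.ite (hm k) (hfm.measurable.enorm.pow_const _) measurable_const
  calc _ ≤ ∑' k : ℤ, (2 : ℝ≥0∞) ^ (k * (2 / p - 1)) *
        ∫⁻ x, (if ‖f x‖ₑ ≤ 2 ^ (-(k / p)) then ‖f x‖ₑ ^ (2 : ℝ) else 0) ∂μ := by
        refine ENNReal.tsum_le_tsum fun k => mul_le_mul_right
          ((ha.tsum_le (hf.indicator (hm k))).trans_eq (lintegral_congr fun x => ?_)) _
        by_cases hx : ‖f x‖ₑ ≤ 2 ^ (-(k / p))
        · rw [Set.indicator_of_mem (s := lowSet f p k) hx, if_pos hx]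
        · rw [Set.indicator_of_notMem (s := lowSet f p k) hx, if_neg hx]
          simp
    _ = ∫⁻ x, ∑' k : ℤ, (2 : ℝ≥0∞) ^ (k * (2 / p - 1)) *
        (if ‖f x‖ₑ ≤ 2 ^ (-(k / p)) then ‖f x‖ₑ ^ (2 : ℝ) else 0) ∂μ := by
        rw [lintegral_tsum fun k => ((hmeas k).const_mul _).aemeasurable]
        exact tsum_congr fun k => (lintegral_const_mul _ (hmeas k)).symm
    _ ≤ ∫⁻ x, (1 - (2 : ℝ≥0∞) ^ (-(2 / p - 1)))⁻¹ * ‖f x‖ₑ ^ p ∂μ :=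
        lintegral_mono fun x => tsum_low_truncation_le hp hp2 _
    _ ≤ _ := by
        rw [lintegral_const_mul _ (hfm.measurable.enorm.pow_const _)]
        exact mul_le_of_le_one_right' hfp

lemma lintegral_high_le {p : ℝ} (hp : 1 < p) {f : X → ℂ}
    (hfp : ∫⁻ x, ‖f x‖ₑ ^ p ∂μ ≤ 1) (k : ℤ) :
    ∫⁻ x, ‖(lowSet f p k)ᶜ.indicator f x‖ₑ ∂μ ≤ 2 ^ (k * (1 - 1 / p)) := by
  have hp0 : 0 < p := by linarith
  calc _ ≤ ∫⁻ x, 2 ^ (k * (1 - 1 / p)) * ‖f x‖ₑ ^ p ∂μ := by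
        refine lintegral_mono fun x => ?_
        by_cases hx : x ∈ lowSet f p k
        · rw [Set.indicator_of_notMem (by simpa using hx)]
          simp
        rw [Set.indicator_of_mem (by simpa using hx)]
        have hx' : 2 ^ (-(k / p)) < ‖f x‖ₑ := not_le.mp hx
        have h0 : ‖f x‖ₑ ≠ 0 := (lt_of_le_of_lt zero_le hx').ne'
        calc ‖f x‖ₑ = ‖f x‖ₑ ^ (1 - p) * ‖f x‖ₑ ^ p := by
              rw [← ENNReal.rpow_add _ _ h0 enorm_ne_top]
              simp
          _ ≤ 2 ^ (k * (1 - 1 / p)) * ‖f x‖ₑ ^ p := by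
              refine mul_le_mul_left ?_ _
              have h1 : (‖f x‖ₑ ^ (p - 1))⁻¹ ≤ ((2 ^ (-(k / p))) ^ (p - 1))⁻¹ :=
                ENNReal.inv_le_inv.mpr (ENNReal.rpow_le_rpow hx'.le (by linarith))
              rw [← ENNReal.rpow_neg, ← ENNReal.rpow_neg, ← ENNReal.rpow_mul, neg_sub] at h1
              refine h1.trans_eq ?_
              congr 1
              field_simp
              ring
    _ ≤ _ := by
        rw [lintegral_const_mul' _ _ (ENNReal.rpow_ne_top_of_ne_zero two_ne_zero
          ENNReal.ofNat_ne_top)]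
        exact mul_le_of_le_one_right' hfp

open Classical in
-- The weak-type hypothesis bounds the total weight of {u ≥ 2^k} by 2^{-k}, so the L¹ bound leaves
-- 2^{-k} N² with N the L¹ norm of the high part. One factor N is estimated by `lintegral_high_le`;
-- the other is kept, making the sum over k linear in |f| and open to Tonelli.
lemma high_sum_le {p : ℝ} (hp : 1 < p) (ha : IsSquareMass μ D a) (u : I → ℝ≥0)
    (hu : ∀ t : ℝ≥0, t * ∑' i, (if t ≤ u i then D i else 0) ≤ 1) {f : X → ℂ}
    (hfm : StronglyMeasurable f) (hf : MemLp f 2 μ) (hfp : ∫⁻ x, ‖f x‖ₑ ^ p ∂μ ≤ 1) :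
    ∑' k : ℤ, (2 : ℝ≥0∞) ^ (k * (2 / p - 1)) *
      ∑' i, (if (2 : ℝ≥0) ^ (k : ℝ) ≤ u i then a ((lowSet f p k)ᶜ.indicator f) i else 0) ≤
      (1 - (2 : ℝ≥0∞) ^ (-(1 - 1 / p)))⁻¹ := by
  have hm := fun k => measurableSet_lowSet hfm p k
  have hp0 : 0 < p := by linarith
  have hmeas : ∀ k : ℤ, Measurable fun x =>
      if ‖f x‖ₑ ≤ 2 ^ (-(k / p)) then 0 else ‖f x‖ₑ := fun k =>
    Measurable.ite (hm k) measurable_const hfm.measurable.enorm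
  have hterm : ∀ k : ℤ, (2 : ℝ≥0∞) ^ (k * (2 / p - 1)) *
      ∑' i, (if (2 : ℝ≥0) ^ (k : ℝ) ≤ u i then a ((lowSet f p k)ᶜ.indicator f) i else 0) ≤
      (2 : ℝ≥0∞) ^ (-(k * (1 - 1 / p))) *
        ∫⁻ x, (if ‖f x‖ₑ ≤ 2 ^ (-(k / p)) then 0 else ‖f x‖ₑ) ∂μ := by
    intro k
    set N := ∫⁻ x, ‖(lowSet f p k)ᶜ.indicator f x‖ₑ ∂μ with hN
    have hN' : ∫⁻ x, (if ‖f x‖ₑ ≤ 2 ^ (-(k / p)) then 0 else ‖f x‖ₑ) ∂μ = N := by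
      refine lintegral_congr fun x => ?_
      by_cases hx : ‖f x‖ₑ ≤ 2 ^ (-(k / p))
      · rw [Set.indicator_of_notMem (by simpa [lowSet] using hx), if_pos hx]
        simp
      · rw [Set.indicator_of_mem (by simpa [lowSet] using hx), if_neg hx]
    have hN1 : N ≤ 2 ^ (k * (1 - 1 / p)) := lintegral_high_le hp hfp k
    have h1 : ∑' i, (if (2 : ℝ≥0) ^ (k : ℝ) ≤ u i then
        a ((lowSet f p k)ᶜ.indicator f) i else 0) ≤
        (∑' i, (if (2 : ℝ≥0) ^ (k : ℝ) ≤ u i then D i else 0)) * N ^ 2 := by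
      rw [← ENNReal.tsum_mul_right]
      refine ENNReal.tsum_le_tsum fun i => ?_
      split_ifs
      · exact ha.le_mul (hf.indicator (hm k).compl) i
      · exact zero_le
    have h2 : ∑' i, (if (2 : ℝ≥0) ^ (k : ℝ) ≤ u i then D i else 0) ≤ 2 ^ (-(k : ℝ)) := by
      have h := hu (2 ^ (k : ℝ))
      rw [ENNReal.coe_rpow_of_ne_zero two_ne_zero, ENNReal.coe_ofNat] at h
      rw [ENNReal.rpow_neg, ENNReal.le_inv_iff_mul_le, mul_comm]
      exact h
    rw [hN']
    calc _ ≤ (2 : ℝ≥0∞) ^ (k * (2 / p - 1)) * (2 ^ (-(k : ℝ)) * (2 ^ (k * (1 - 1 / p)) * N)) := by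
          refine mul_le_mul_right (h1.trans ?_) _
          rw [sq]
          exact mul_le_mul' h2 (mul_le_mul_left hN1 _)
      _ = (2 : ℝ≥0∞) ^ (-(k * (1 - 1 / p))) * N := by
          rw [← mul_assoc, ← mul_assoc, ← two_rpow_add, ← two_rpow_add]
          congr 2
          field_simp
          ring
  calc _ ≤ _ := ENNReal.tsum_le_tsum hterm
    _ = ∫⁻ x, ∑' k : ℤ, (2 : ℝ≥0∞) ^ (-(k * (1 - 1 / p))) *
        (if ‖f x‖ₑ ≤ 2 ^ (-(k / p)) then 0 else ‖f x‖ₑ) ∂μ := by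
        rw [lintegral_tsum fun k => ((hmeas k).const_mul _).aemeasurable]
        exact tsum_congr fun k => (lintegral_const_mul _ (hmeas k)).symm
    _ ≤ ∫⁻ x, (1 - (2 : ℝ≥0∞) ^ (-(1 - 1 / p)))⁻¹ * ‖f x‖ₑ ^ p ∂μ :=
        lintegral_mono fun x => tsum_high_truncation_le hp _
    _ ≤ _ := by
        rw [lintegral_const_mul _ (hfm.measurable.enorm.pow_const _)]
        exact mul_le_of_le_one_right' hfp

end Truncation

/-- The constant in Paley's inequality. -/
def paleyConst (p : ℝ) : ℝ≥0∞ :=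
  if p = 2 then 1 else 2 ^ (2 / p - 1) * 2 *
    ((1 - (2 : ℝ≥0∞) ^ (-(2 / p - 1)))⁻¹ + (1 - (2 : ℝ≥0∞) ^ (-(1 - 1 / p)))⁻¹)

lemma paleyConst_ne_top {p : ℝ} (hp : 1 < p) (hp2 : p ≤ 2) : paleyConst p ≠ ⊤ := by
  rw [paleyConst]
  split_ifs with h
  · simp
  have hp0 : 0 < p := by linarith
  have hlt : p < 2 := lt_of_le_of_ne hp2 h
  refine ENNReal.mul_ne_top (ENNReal.mul_ne_top ?_ (by simp)) (ENNReal.add_ne_top.mpr ⟨?_, ?_⟩)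
  · exact ENNReal.rpow_ne_top_of_ne_zero two_ne_zero ENNReal.ofNat_ne_top
  · exact one_sub_two_rpow_neg_inv_ne_top (by rw [sub_pos, lt_div_iff₀ hp0]; linarith)
  · exact one_sub_two_rpow_neg_inv_ne_top (by rw [sub_pos, div_lt_one hp0]; exact hp)

open Classical in
/-- **Paley's inequality** for square masses. -/
theorem IsSquareMass.paley {X I : Type*} [MeasurableSpace X] {μ : Measure X} {D : I → ℝ≥0∞}
    {a : (X → ℂ) → I → ℝ≥0∞} (ha : IsSquareMass μ D a) {p : ℝ} (hp : 1 < p) (hp2 : p ≤ 2)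
    (u : I → ℝ≥0) (hu : ∀ t : ℝ≥0, t * ∑' i, (if t ≤ u i then D i else 0) ≤ 1) {f : X → ℂ}
    (hfm : StronglyMeasurable f) (hf : MemLp f 2 μ) (hfp : ∫⁻ x, ‖f x‖ₑ ^ p ∂μ ≤ 1) :
    ∑' i, (u i : ℝ≥0∞) ^ (2 / p - 1) * a f i ≤ paleyConst p := by
  have hp0 : 0 < p := by linarith
  rw [paleyConst]
  split_ifs with h2
  -- At p = 2 the weight exponent vanishes and the L² bound suffices; the geometric constant for the
  -- low parts would be infinite.
  · subst h2
    refine le_trans ?_ ((ha.tsum_le hf).trans hfp)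
    simp
  have hlt : p < 2 := lt_of_le_of_ne hp2 h2
  set β := 2 / p - 1 with hβ
  have hβ0 : 0 < β := by rw [hβ, sub_pos, lt_div_iff₀ hp0]; linarith
  have hm := fun k => measurableSet_lowSet hfm p k
  have hsplit : ∀ i k, a f i ≤
      2 * (a ((lowSet f p k).indicator f) i + a ((lowSet f p k)ᶜ.indicator f) i) := by
    intro i k
    have := ha.add_le (hf.indicator (hm k)) (hf.indicator (hm k).compl) i
    rwa [Set.indicator_self_add_compl] at this
  calc ∑' i, (u i : ℝ≥0∞) ^ β * a f i
      ≤ ∑' i, ∑' k : ℤ, 2 ^ β * 2 * (2 ^ (k * β) * (a ((lowSet f p k).indicator f) i) +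
          2 ^ (k * β) * (if (2 : ℝ≥0) ^ (k : ℝ) ≤ u i then
            a ((lowSet f p k)ᶜ.indicator f) i else 0)) := by
        refine ENNReal.tsum_le_tsum fun i => ?_
        refine (mul_le_mul_left (rpow_le_two_rpow_mul_tsum hβ0 (u i)) _).trans ?_
        rw [← ENNReal.tsum_mul_left, ← ENNReal.tsum_mul_right]
        refine ENNReal.tsum_le_tsum fun k => ?_
        split_ifs
        · refine (mul_le_mul_right (hsplit i k) _).trans_eq ?_
          ring
        · simp
    _ = 2 ^ β * 2 * (∑' k : ℤ, (2 : ℝ≥0∞) ^ (k * β) *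
            ∑' i, a ((lowSet f p k).indicator f) i +
          ∑' k : ℤ, (2 : ℝ≥0∞) ^ (k * β) * ∑' i, (if (2 : ℝ≥0) ^ (k : ℝ) ≤ u i then
            a ((lowSet f p k)ᶜ.indicator f) i else 0)) := by
        rw [ENNReal.tsum_comm, ← ENNReal.tsum_add, ← ENNReal.tsum_mul_left]
        refine tsum_congr fun k => ?_
        rw [ENNReal.tsum_mul_left, ENNReal.tsum_add, ENNReal.tsum_mul_left,
          ENNReal.tsum_mul_left]
    _ ≤ _ := mul_le_mul_right (add_le_add (low_sum_le hp0 hlt ha hfm hf hfp)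
        (high_sum_le hp ha u hu hfm hf hfp)) _

end PaleyAbstract

/-! ### Fourier masses and the bilinear estimate -/

section CoeffMass

variable {G : Type*} [Group G] [TopologicalSpace G] [IsTopologicalGroup G] [CompactSpace G]
  [MeasurableSpace G] [BorelSpace G] (μ : Measure G) [μ.IsHaarMeasure] [IsProbabilityMeasure μ]

/-- The squared mass `d_ξ ‖f̂(ξ)‖²` (Hilbert–Schmidt norm) of a Fourier coefficient. -/
def coeffMass (f : G → ℂ) (ξ : UnitaryDual G) : ℝ≥0∞ :=
  ξ.rep.dim * ∑ l, ∑ m, ‖∫ x, f x * (starRingEnd ℂ) (ξ.rep.mat x l m) ∂μ‖ₑ ^ 2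

lemma inner_lpCoeff_eq_integral {f : G → ℂ} {F : Lp ℂ 2 μ} (hF : F =ᵐ[μ] f)
    (ξ : UnitaryIrrep G) (l m : Fin ξ.dim) :
    inner ℂ (ξ.lpCoeff μ l m) F = ∫ x, f x * (starRingEnd ℂ) (ξ.mat x l m) ∂μ := by
  rw [L2.inner_def]
  refine integral_congr_ae ?_
  filter_upwards [hF, ContinuousMap.coeFn_toLp (E := ℂ) (p := 2) (𝕜 := ℂ) μ (ξ.coeff l m)]
    with x h1 h2
  rw [UnitaryIrrep.lpCoeff, h1, h2]
  rfl

lemma coeffMass_eq_of_ae_eq {f : G → ℂ} {F : Lp ℂ 2 μ} (hF : F =ᵐ[μ] f) (ξ : UnitaryDual G) :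
    coeffMass μ f ξ =
      ∑ lm : Fin ξ.rep.dim × Fin ξ.rep.dim, ‖inner ℂ (coeffBasis μ ⟨ξ, lm⟩) F‖ₑ ^ 2 := by
  rw [coeffMass, Fintype.sum_prod_type, Finset.mul_sum]
  refine Finset.sum_congr rfl fun l _ => ?_
  rw [Finset.mul_sum]
  refine Finset.sum_congr rfl fun m _ => ?_
  rw [coeffBasis_apply, normalizedCoeff, inner_smul_left, inner_lpCoeff_eq_integral μ hF,
    enorm_mul, mul_pow, Complex.conj_ofReal]
  congr 1
  rw [← ofReal_norm, ← ENNReal.ofReal_pow (norm_nonneg _), Complex.norm_real,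
    Real.norm_of_nonneg (Real.sqrt_nonneg _), Real.sq_sqrt (by positivity)]
  simp

lemma lintegral_enorm_sq_eq {f : G → ℂ} {F : Lp ℂ 2 μ} (hF : F =ᵐ[μ] f) :
    ∫⁻ x, ‖f x‖ₑ ^ (2 : ℝ) ∂μ = ‖F‖ₑ ^ 2 := by
  rw [Lp.enorm_def, eLpNorm_congr_ae hF, eLpNorm_eq_lintegral_rpow_enorm_toReal (by simp) (by simp)]
  rw [← ENNReal.rpow_natCast, ← ENNReal.rpow_mul]
  simp

lemma tsum_coeffMass_le {f : G → ℂ} (hf : MemLp f 2 μ) :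
    ∑' ξ, coeffMass μ f ξ ≤ ∫⁻ x, ‖f x‖ₑ ^ (2 : ℝ) ∂μ := by
  have hF : hf.toLp f =ᵐ[μ] f := hf.coeFn_toLp
  rw [lintegral_enorm_sq_eq μ hF]
  have h1 : ∑' ξ, coeffMass μ f ξ =
      ∑' k : CoeffIndex G, ‖inner ℂ (coeffBasis μ k) (hf.toLp f)‖ₑ ^ 2 := by
    rw [ENNReal.tsum_sigma']
    refine tsum_congr fun ξ => ?_
    rw [tsum_fintype]
    exact coeffMass_eq_of_ae_eq μ hF ξ
  have h2 : ∀ z : ℂ, ‖z‖ₑ ^ 2 = ENNReal.ofReal (‖z‖ ^ 2) := fun z => by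
    rw [← ofReal_norm, ENNReal.ofReal_pow (norm_nonneg _)]
  simp_rw [h1, h2]
  rw [← ENNReal.ofReal_tsum_of_nonneg (fun _ => by positivity)
    ((coeffBasis μ).orthonormal.inner_products_summable _),
    ← ofReal_norm, ← ENNReal.ofReal_pow (norm_nonneg _)]
  exact ENNReal.ofReal_le_ofReal ((coeffBasis μ).orthonormal.tsum_inner_products_le _)

lemma integrable_mul_conj_mat {f : G → ℂ} (hf : Integrable f μ) (ξ : UnitaryIrrep G)
    (l m : Fin ξ.dim) : Integrable (fun x => f x * (starRingEnd ℂ) (ξ.mat x l m)) μ := by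
  have hc : Continuous fun x => (starRingEnd ℂ) (ξ.mat x l m) :=
    Complex.continuous_conj.comp (ξ.continuous_mat_apply l m)
  obtain ⟨C, hC⟩ := isCompact_univ.exists_bound_of_continuousOn hc.continuousOn
  exact hf.mul_bdd (c := C) hc.aestronglyMeasurable
    (Filter.Eventually.of_forall fun x => hC x (Set.mem_univ x))

lemma coeffMass_add_le {g h : G → ℂ} (hg : Integrable g μ) (hh : Integrable h μ)
    (ξ : UnitaryDual G) : coeffMass μ (g + h) ξ ≤ 2 * (coeffMass μ g ξ + coeffMass μ h ξ) := by
  have hz : ∀ z w : ℂ, ‖z + w‖ₑ ^ 2 ≤ 2 * (‖z‖ₑ ^ 2 + ‖w‖ₑ ^ 2) := fun z w => by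
    refine (pow_le_pow_left' (enorm_add_le z w) 2).trans ?_
    simp only [enorm_eq_nnnorm]
    norm_cast
    exact add_sq_le
  rw [coeffMass, coeffMass, coeffMass, ← mul_add, mul_left_comm]
  refine mul_le_mul_right ?_ _
  rw [← Finset.sum_add_distrib, Finset.mul_sum]
  refine Finset.sum_le_sum fun l _ => ?_
  rw [← Finset.sum_add_distrib, Finset.mul_sum]
  refine Finset.sum_le_sum fun m _ => ?_
  refine le_of_eq_of_le ?_ (hz _ _)
  rw [← integral_add (integrable_mul_conj_mat μ hg _ l m) (integrable_mul_conj_mat μ hh _ l m)]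
  simp [add_mul]

lemma sum_norm_mat_sq (ξ : UnitaryIrrep G) (x : G) :
    ∑ lm : Fin ξ.dim × Fin ξ.dim, ‖ξ.mat x lm.1 lm.2‖ ^ 2 = ξ.dim := by
  rw [Fintype.sum_prod_type, Finset.sum_comm]
  have h : ∀ m, ∑ l, ‖ξ.mat x l m‖ ^ 2 = 1 := fun m => by
    have := congrFun (congrFun (ξ.conjTranspose_mul_mat x) m) m
    rw [Matrix.mul_apply, Matrix.one_apply_eq] at this
    simp only [Matrix.conjTranspose_apply, ← starRingEnd_apply, Complex.conj_mul'] at this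
    exact_mod_cast this
  simp [h]

/-- The d² coefficients form one vector-valued integral whose integrand has norm √d |h(x)|, since
ξ(x) is unitary. The triangle inequality bounds its norm by √d ‖h‖₁; squaring, with the factor d in
the mass, gives d². -/
lemma coeffMass_le {h : G → ℂ} (hh : Integrable h μ) (ξ : UnitaryDual G) :
    coeffMass μ h ξ ≤ (ξ.rep.dim : ℝ≥0∞) ^ 2 * (∫⁻ x, ‖h x‖ₑ ∂μ) ^ 2 := by
  let v : G → EuclideanSpace ℂ (Fin ξ.rep.dim × Fin ξ.rep.dim) := fun x =>
    WithLp.toLp 2 fun lm => h x * (starRingEnd ℂ) (ξ.rep.mat x lm.1 lm.2)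
  have hint : Integrable v μ := by
    have : Integrable (fun x => fun lm : Fin ξ.rep.dim × Fin ξ.rep.dim =>
        h x * (starRingEnd ℂ) (ξ.rep.mat x lm.1 lm.2)) μ :=
      Integrable.of_eval fun lm => integrable_mul_conj_mat μ hh _ lm.1 lm.2
    exact (EuclideanSpace.equiv (Fin ξ.rep.dim × Fin ξ.rep.dim)
      ℂ).symm.toContinuousLinearMap.integrable_comp this
  have hcoord : ∀ lm, (∫ x, v x ∂μ) lm =
      ∫ x, h x * (starRingEnd ℂ) (ξ.rep.mat x lm.1 lm.2) ∂μ := fun lm =>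
    ((EuclideanSpace.proj (𝕜 := ℂ) lm).integral_comp_comm hint).symm
  have hnormsq : ∀ w : EuclideanSpace ℂ (Fin ξ.rep.dim × Fin ξ.rep.dim),
      ‖w‖ₑ ^ 2 = ∑ lm, ‖w lm‖ₑ ^ 2 := fun w => by
    rw [← ofReal_norm, ← ENNReal.ofReal_pow (norm_nonneg _), EuclideanSpace.norm_sq_eq,
      ENNReal.ofReal_sum_of_nonneg (fun _ _ => by positivity)]
    refine Finset.sum_congr rfl fun lm _ => ?_
    rw [← ofReal_norm, ENNReal.ofReal_pow (norm_nonneg _)]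
  have hv : ∀ x, ‖v x‖ₑ = ENNReal.ofReal (Real.sqrt ξ.rep.dim) * ‖h x‖ₑ := fun x => by
    rw [← ofReal_norm, ← ofReal_norm, ← ENNReal.ofReal_mul (Real.sqrt_nonneg _)]
    congr 1
    rw [EuclideanSpace.norm_eq, ← sum_norm_mat_sq ξ.rep x]
    simp only [v, norm_mul, mul_pow, RCLike.norm_conj]
    rw [← Finset.mul_sum, Real.sqrt_mul (by positivity), Real.sqrt_sq (norm_nonneg _), mul_comm]
  have hdd : ENNReal.ofReal (Real.sqrt ξ.rep.dim) ^ 2 = ξ.rep.dim := by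
    rw [← ENNReal.ofReal_pow (Real.sqrt_nonneg _), Real.sq_sqrt (by positivity)]
    simp
  have hmain : coeffMass μ h ξ = ξ.rep.dim * ‖∫ x, v x ∂μ‖ₑ ^ 2 := by
    rw [hnormsq, coeffMass, Fintype.sum_prod_type]
    simp_rw [hcoord]
  rw [hmain]
  calc _ ≤ (ξ.rep.dim : ℝ≥0∞) * (∫⁻ x, ‖v x‖ₑ ∂μ) ^ 2 :=
        mul_le_mul_right (pow_le_pow_left' (enorm_integral_le_lintegral_enorm _) 2) _
    _ = _ := by
        simp_rw [hv]
        rw [lintegral_const_mul' _ _ ENNReal.ofReal_ne_top, mul_pow, hdd]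
        ring

lemma isSquareMass_coeffMass :
    IsSquareMass μ (fun ξ : UnitaryDual G => (ξ.rep.dim : ℝ≥0∞) ^ 2) (coeffMass μ) where
  add_le hg hh := coeffMass_add_le μ (hg.integrable (by simp)) (hh.integrable (by simp))
  tsum_le hg := tsum_coeffMass_le μ hg
  le_mul hg := coeffMass_le μ (hg.integrable (by simp))

variable {μ} {A : Lp ℂ 2 μ →ₗ.[ℂ] Lp ℂ 2 μ}

lemma sum_enorm_mulVec_sq_le {d : ℕ} (S : Matrix (Fin d) (Fin d) ℂ) (c : Fin d → ℂ) :
    ∑ n, ‖∑ m, S n m * c m‖ₑ ^ 2 ≤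
      (‖Matrix.toEuclideanCLM (n := Fin d) (𝕜 := ℂ) S‖₊ : ℝ≥0∞) ^ 2 * ∑ m, ‖c m‖ₑ ^ 2 := by
  have h := (Matrix.toEuclideanCLM (n := Fin d) (𝕜 := ℂ) S).le_opNorm (WithLp.toLp 2 c)
  have h2 := pow_le_pow_left₀ (norm_nonneg _) h 2
  rw [mul_pow, EuclideanSpace.norm_sq_eq, EuclideanSpace.norm_sq_eq] at h2
  have h3 : ∀ n, (Matrix.toEuclideanCLM (n := Fin d) (𝕜 := ℂ) S (WithLp.toLp 2 c)) n =
      ∑ m, S n m * c m := fun n => rfl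
  simp_rw [h3] at h2
  simp only [enorm_eq_nnnorm]
  norm_cast
  rw [← NNReal.coe_le_coe]
  push_cast
  exact h2

lemma IsLeftFourierMultiplier.coeffMass_apply_le (hA : IsLeftFourierMultiplier μ A)
    (f : A.domain) (ξ : UnitaryDual G) :
    coeffMass μ (A f) ξ ≤ (symbolNorm μ A ξ.rep : ℝ≥0∞) ^ 2 *
      coeffMass μ ((f : Lp ℂ 2 μ) : G → ℂ) ξ := by
  rw [coeffMass, coeffMass, mul_left_comm]
  refine mul_le_mul_right ?_ _
  rw [Finset.mul_sum]
  refine Finset.sum_le_sum fun l _ => ?_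
  simp_rw [← inner_lpCoeff_eq_integral μ (Filter.EventuallyEq.refl _ _),
    hA.inner_lpCoeff_apply f ξ l]
  exact sum_enorm_mulVec_sq_le _ _

/-- Weighted arithmetic-geometric inequality up to a factor 2: one of the two terms already
dominates, according to whether cx or y is larger. -/
lemma mul_le_mul_sq_add {x y c : ℝ≥0∞} (hc : c ≠ 0) (hc' : c ≠ ⊤) :
    x * y ≤ c * x ^ 2 + c⁻¹ * y ^ 2 := by
  rcases le_total (c * x) y with h | h
  · refine le_trans ?_ le_add_self
    have hx : x ≤ c⁻¹ * y := by
      rw [← ENNReal.div_eq_inv_mul, ENNReal.le_div_iff_mul_le (Or.inl hc) (Or.inl hc'), mul_comm]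
      exact h
    calc x * y ≤ c⁻¹ * y * y := mul_le_mul' hx le_rfl
      _ = _ := by ring
  · refine le_trans ?_ le_self_add
    calc x * y ≤ x * (c * x) := mul_le_mul' le_rfl h
      _ = _ := by ring

/-- The bilinear estimate for a left Fourier multiplier whose symbol is bounded by
`M (U V)^{1/2}`. -/
lemma IsLeftFourierMultiplier.enorm_inner_apply_le (hA : IsLeftFourierMultiplier μ A)
    (f : A.domain) (h : Lp ℂ 2 μ) {M : ℝ≥0∞} (hM : M ≠ 0) (hM' : M ≠ ⊤)
    {U V : UnitaryDual G → ℝ≥0∞} (hV : ∀ ξ, V ξ ≠ ⊤)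
    (hw : ∀ ξ, (symbolNorm μ A ξ.rep : ℝ≥0∞) ^ 2 ≤ M ^ 2 * (U ξ * V ξ)) :
    ‖inner ℂ h (A f)‖ₑ ≤ M * (∑' ξ, U ξ * coeffMass μ ((f : Lp ℂ 2 μ) : G → ℂ) ξ +
      ∑' ξ, V ξ * coeffMass μ h ξ) := by
  -- Parseval for the pairing; here completeness of the basis, that is Peter–Weyl, is needed.
  rw [← (coeffBasis μ).tsum_inner_mul_inner]
  refine enorm_tsum_le_tsum_enorm.trans ?_
  rw [ENNReal.tsum_sigma', ← ENNReal.tsum_add, ← ENNReal.tsum_mul_left]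
  refine ENNReal.tsum_le_tsum fun ξ => ?_
  rw [tsum_fintype]
  have hmass := hA.coeffMass_apply_le f ξ
  rw [coeffMass_eq_of_ae_eq μ (Filter.EventuallyEq.refl _ (A f : G → ℂ))] at hmass
  have hsymm : ∀ k, ‖inner ℂ h (coeffBasis μ k)‖ₑ = ‖inner ℂ (coeffBasis μ k) h‖ₑ := fun k => by
    rw [← ofReal_norm, ← ofReal_norm, norm_inner_symm]
  -- The splitting parameter M·V(ξ) must be nonzero. If V(ξ) = 0, the symbol vanishes at ξ and the
  -- whole block contributes nothing.
  by_cases hV0 : V ξ = 0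
  · have hw0 : (symbolNorm μ A ξ.rep : ℝ≥0∞) ^ 2 = 0 := by
      have := hw ξ
      rw [hV0] at this
      simpa using this
    rw [hw0, zero_mul, nonpos_iff_eq_zero, Finset.sum_eq_zero_iff] at hmass
    refine le_of_eq_of_le (Finset.sum_eq_zero fun lm hlm => ?_) zero_le
    have h0 := hmass lm hlm
    rw [sq_eq_zero_iff] at h0
    rw [enorm_mul, h0, mul_zero]
  -- The parameter c = M·V(ξ) turns the bound M² U V into c⁻¹ M² U V = M U, separating the weights
  -- of f and h.
  have hc : M * V ξ ≠ 0 := mul_ne_zero hM hV0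
  have hc' : M * V ξ ≠ ⊤ := ENNReal.mul_ne_top hM' (hV ξ)
  calc _ ≤ ∑ lm : Fin ξ.rep.dim × Fin ξ.rep.dim,
        (M * V ξ * ‖inner ℂ (coeffBasis μ ⟨ξ, lm⟩) h‖ₑ ^ 2 +
          (M * V ξ)⁻¹ * ‖inner ℂ (coeffBasis μ ⟨ξ, lm⟩) (A f)‖ₑ ^ 2) := by
        refine Finset.sum_le_sum fun lm _ => ?_
        rw [enorm_mul, hsymm]
        exact mul_le_mul_sq_add hc hc'
    _ ≤ M * V ξ * coeffMass μ h ξ + (M * V ξ)⁻¹ * (M ^ 2 * (U ξ * V ξ) *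
          coeffMass μ ((f : Lp ℂ 2 μ) : G → ℂ) ξ) := by
        rw [Finset.sum_add_distrib, ← Finset.mul_sum, ← Finset.mul_sum,
          coeffMass_eq_of_ae_eq μ (Filter.EventuallyEq.refl _ (h : G → ℂ))]
        exact add_le_add le_rfl (mul_le_mul_right (hmass.trans (mul_le_mul_left (hw ξ) _)) _)
    _ = M * (U ξ * coeffMass μ ((f : Lp ℂ 2 μ) : G → ℂ) ξ + V ξ * coeffMass μ h ξ) := by
        have : (M * V ξ)⁻¹ * (M ^ 2 * (U ξ * V ξ) * coeffMass μ ((f : Lp ℂ 2 μ) : G → ℂ) ξ) =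
            ((M * V ξ)⁻¹ * (M * V ξ)) * (M * (U ξ * coeffMass μ ((f : Lp ℂ 2 μ) : G → ℂ) ξ)) := by
          ring
        rw [this, ENNReal.inv_mul_cancel hc hc']
        ring

end CoeffMass

/-! ### L^q norms by duality -/

section Duality

variable {X : Type*} [MeasurableSpace X] {μ : Measure X} [IsFiniteMeasure μ]

/-- The truncated duality function `1_{|v| ≤ n} |v|^{q-2} v`. -/
def dualTruncation (v : X → ℂ) (q : ℝ) (n : ℕ) : X → ℂ :=
  {x | ‖v x‖ ≤ n}.indicator fun x => ((‖v x‖ ^ (q - 2) : ℝ) : ℂ) * v x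

lemma stronglyMeasurable_dualTruncation {v : X → ℂ} (hv : StronglyMeasurable v) (q : ℝ) (n : ℕ) :
    StronglyMeasurable (dualTruncation v q n) := by
  refine StronglyMeasurable.indicator ?_ (measurableSet_le hv.measurable.norm measurable_const)
  have : Measurable fun x => ((‖v x‖ ^ (q - 2) : ℝ) : ℂ) * v x :=
    (Complex.measurable_ofReal.comp (hv.measurable.norm.pow_const _)).mul hv.measurable
  exact this.stronglyMeasurable

lemma norm_dualTruncation {v : X → ℂ} {q : ℝ} (hq : 2 ≤ q) (n : ℕ) (x : X) :
    ‖dualTruncation v q n x‖ = {x | ‖v x‖ ≤ n}.indicator (fun x => ‖v x‖ ^ (q - 1)) x := by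
  by_cases hx : x ∈ {x | ‖v x‖ ≤ n}
  · rw [dualTruncation, Set.indicator_of_mem hx, Set.indicator_of_mem hx, norm_mul,
      Complex.norm_real, Real.norm_of_nonneg (by positivity)]
    rw [show q - 1 = (q - 2) + 1 by ring, Real.rpow_add_one' (norm_nonneg _) (by linarith)]
  · rw [dualTruncation, Set.indicator_of_notMem hx, Set.indicator_of_notMem hx, norm_zero]

lemma memLp_dualTruncation {v : X → ℂ} (hv : StronglyMeasurable v) {q : ℝ} (hq : 2 ≤ q) (n : ℕ) :
    MemLp (dualTruncation v q n) 2 μ := by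
  refine MemLp.of_bound (stronglyMeasurable_dualTruncation hv q n).aestronglyMeasurable
    ((n : ℝ) ^ (q - 1)) (Filter.Eventually.of_forall fun x => ?_)
  rw [norm_dualTruncation hq]
  refine Set.indicator_apply_le' (fun hx => ?_) (fun _ => by positivity)
  exact Real.rpow_le_rpow (norm_nonneg _) hx (by linarith)

lemma mul_conj_dualTruncation {v : X → ℂ} {q : ℝ} (hq : 2 ≤ q) (n : ℕ) (x : X) :
    v x * (starRingEnd ℂ) (dualTruncation v q n x) =
      (({x | ‖v x‖ ≤ n}.indicator (fun x => ‖v x‖ ^ q) x : ℝ) : ℂ) := by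
  by_cases hx : x ∈ {x | ‖v x‖ ≤ n}
  · rw [dualTruncation, Set.indicator_of_mem hx, Set.indicator_of_mem hx, map_mul,
      Complex.conj_ofReal, mul_left_comm, Complex.mul_conj', ← Complex.ofReal_pow,
      ← Complex.ofReal_mul]
    congr 1
    rw [← Real.rpow_natCast, ← Real.rpow_add' (norm_nonneg _) (by norm_num; linarith)]
    norm_num
  · rw [dualTruncation, Set.indicator_of_notMem hx, Set.indicator_of_notMem hx]
    simp

/-- Duality characterization of the `L^q` norm. -/
lemma lintegral_rpow_le_of_dual {v : X → ℂ} (hv : StronglyMeasurable v) {q : ℝ} (hq : 2 ≤ q)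
    {K : ℝ≥0∞}
    (hK : ∀ h : X → ℂ, StronglyMeasurable h → MemLp h 2 μ →
      ∫⁻ x, ‖h x‖ₑ ^ (q / (q - 1)) ∂μ ≤ 1 →
      ‖∫ x, v x * (starRingEnd ℂ) (h x) ∂μ‖ₑ ≤ K) :
    ∫⁻ x, ‖v x‖ₑ ^ q ∂μ ≤ K ^ q := by
  have hq0 : 0 < q := by linarith
  have hq1 : 0 < q - 1 := by linarith
  have hset : ∀ n : ℕ, MeasurableSet {x | ‖v x‖ ≤ n} := fun n =>
    measurableSet_le hv.measurable.norm measurable_const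
  let I : ℕ → ℝ := fun n => ∫ x, {x | ‖v x‖ ≤ n}.indicator (fun x => ‖v x‖ ^ q) x ∂μ
  have hnn : ∀ (n : ℕ) x, 0 ≤ {x | ‖v x‖ ≤ n}.indicator (fun x => ‖v x‖ ^ q) x := fun n x =>
    Set.indicator_nonneg (fun _ _ => by positivity) x
  have hI0 : ∀ n, 0 ≤ I n := fun n => integral_nonneg (hnn n)
  have hint : ∀ n : ℕ, Integrable ({x | ‖v x‖ ≤ n}.indicator (fun x => ‖v x‖ ^ q)) μ := by
    intro n
    refine Integrable.of_bound
      ((hv.measurable.norm.pow_const q).indicator (hset n)).aestronglyMeasurable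
      ((n : ℝ) ^ q) (Filter.Eventually.of_forall fun x => ?_)
    rw [Real.norm_of_nonneg (hnn n x)]
    exact Set.indicator_apply_le' (fun hx => Real.rpow_le_rpow (norm_nonneg _) hx hq0.le)
      (fun _ => by positivity)
  have hIl : ∀ n, ENNReal.ofReal (I n) =
      ∫⁻ x, {x | ‖v x‖ ≤ n}.indicator (fun x => ‖v x‖ₑ ^ q) x ∂μ := by
    intro n
    rw [ofReal_integral_eq_lintegral_ofReal (hint n) (Filter.Eventually.of_forall (hnn n))]
    refine lintegral_congr fun x => ?_
    by_cases hx : x ∈ {x | ‖v x‖ ≤ n}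
    · rw [Set.indicator_of_mem hx, Set.indicator_of_mem hx, ← ofReal_norm,
        ENNReal.ofReal_rpow_of_nonneg (norm_nonneg _) hq0.le]
    · rw [Set.indicator_of_notMem hx, Set.indicator_of_notMem hx, ENNReal.ofReal_zero]
  have hbound : ∀ n, ENNReal.ofReal (I n) ≤ K ^ q := by
    intro n
    rcases (hI0 n).eq_or_lt with h0 | hpos
    · rw [← h0, ENNReal.ofReal_zero]; exact zero_le
    -- This normalization gives the truncated dual function unit norm in L^{q/(q-1)}, and its
    -- pairing with v is then c·I(n) = I(n)^{1/q}. Truncation keeps I(n) finite without assuming v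
    -- in L^q; monotone convergence removes it at the end.
    set c : ℝ := (I n) ^ (-((q - 1) / q)) with hc
    have hc0 : 0 < c := Real.rpow_pos_of_pos hpos _
    have h1 := hK (fun x => (c : ℂ) * dualTruncation v q n x)
      ((stronglyMeasurable_dualTruncation hv q n).const_mul _)
      ((memLp_dualTruncation hv hq n).const_mul _) (by
        have hx : ∀ x, ‖(c : ℂ) * dualTruncation v q n x‖ₑ ^ (q / (q - 1)) =
            ENNReal.ofReal (c ^ (q / (q - 1))) *
              {x | ‖v x‖ ≤ n}.indicator (fun x => ‖v x‖ₑ ^ q) x := by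
          intro x
          rw [← ofReal_norm, norm_mul, norm_dualTruncation hq, Complex.norm_real,
            Real.norm_of_nonneg hc0.le, ENNReal.ofReal_mul hc0.le,
            ENNReal.mul_rpow_of_nonneg _ _ (by positivity),
            ENNReal.ofReal_rpow_of_nonneg hc0.le (by positivity)]
          congr 1
          by_cases hx : x ∈ {x | ‖v x‖ ≤ n}
          · rw [Set.indicator_of_mem hx, Set.indicator_of_mem hx, ← ofReal_norm,
              ENNReal.ofReal_rpow_of_nonneg (by positivity) (by positivity),
              ENNReal.ofReal_rpow_of_nonneg (by positivity) (by positivity),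
              ← Real.rpow_mul (norm_nonneg _)]
            congr 2
            field_simp
          · rw [Set.indicator_of_notMem hx, Set.indicator_of_notMem hx, ENNReal.ofReal_zero,
              ENNReal.zero_rpow_of_pos (by positivity)]
        simp_rw [hx]
        rw [lintegral_const_mul' _ _ ENNReal.ofReal_ne_top, ← hIl,
          ← ENNReal.ofReal_mul (by positivity), hc, ← Real.rpow_mul hpos.le]
        have : -((q - 1) / q) * (q / (q - 1)) = -1 := by field_simp
        rw [this, Real.rpow_neg_one, inv_mul_cancel₀ hpos.ne', ENNReal.ofReal_one])
    have h2 : ∫ x, v x * (starRingEnd ℂ) ((c : ℂ) * dualTruncation v q n x) ∂μ =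
        ((c * I n : ℝ) : ℂ) := by
      simp_rw [map_mul, mul_left_comm (v _), mul_conj_dualTruncation hq, Complex.conj_ofReal]
      rw [integral_const_mul, integral_complex_ofReal, Complex.ofReal_mul]
    rw [h2, ← ofReal_norm, Complex.norm_real, Real.norm_of_nonneg (by positivity)] at h1
    have h3 : c * I n = (I n) ^ (1 / q) := by
      rw [hc, ← Real.rpow_add_one hpos.ne']
      congr 1
      field_simp
      ring
    rw [h3] at h1
    have h4 := ENNReal.rpow_le_rpow h1 hq0.le
    rw [ENNReal.ofReal_rpow_of_nonneg (by positivity) hq0.le, ← Real.rpow_mul hpos.le] at h4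
    rwa [one_div, inv_mul_cancel₀ hq0.ne', Real.rpow_one] at h4
  have hsup : ∀ x, ‖v x‖ₑ ^ q =
      ⨆ n : ℕ, {x | ‖v x‖ ≤ n}.indicator (fun x => ‖v x‖ₑ ^ q) x := by
    intro x
    refine le_antisymm ?_ (iSup_le fun n => Set.indicator_le_self' (fun _ _ => zero_le) x)
    obtain ⟨n, hn⟩ := exists_nat_ge ‖v x‖
    refine le_iSup_of_le n ?_
    rw [Set.indicator_of_mem (by exact hn)]
  rw [lintegral_congr hsup, lintegral_iSup (fun n => (hv.measurable.enorm.pow_const q).indicator (hset n))]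
  · refine iSup_le fun n => ?_
    rw [← hIl]
    exact hbound n
  · intro m n hmn x
    refine Set.indicator_le_indicator_of_subset (fun y hy => ?_) (fun _ => zero_le) x
    exact le_trans (show ‖v y‖ ≤ m from hy) (by exact_mod_cast hmn)

end Duality

/-! ### Assembly of the multiplier bound -/

section Main

variable {G : Type*} [Group G] [TopologicalSpace G] [IsTopologicalGroup G] [CompactSpace G]
  [MeasurableSpace G] [BorelSpace G] {μ : Measure G} [μ.IsHaarMeasure] [IsProbabilityMeasure μ]
  {A : Lp ℂ 2 μ →ₗ.[ℂ] Lp ℂ 2 μ}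

open Classical in
lemma levelSum_eq_tsum_ite (s : ℝ≥0) : levelSum μ A s =
    ∑' ξ : UnitaryDual G, if s ≤ symbolNorm μ A ξ.rep then (ξ.rep.dim : ℝ≥0∞) ^ 2 else 0 := by
  refine (tsum_subtype {ξ : UnitaryDual G | s ≤ symbolNorm μ A ξ.rep}
    (fun ξ => (ξ.rep.dim : ℝ≥0∞) ^ 2)).trans ?_
  exact tsum_congr fun ξ => by rw [Set.indicator_apply]; rfl

/-- The multiplier bound, given a weight `u` of weak type `ℓ¹` dominating the symbol. -/
lemma IsLeftFourierMultiplier.lpLqNorm_le (hA : IsLeftFourierMultiplier μ A) {p q : ℝ}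
    (hp : 1 < p) (hp2 : p ≤ 2) (hq : 2 ≤ q) {M : ℝ≥0} (hM : M ≠ 0) (u : UnitaryDual G → ℝ≥0)
    (hu : ∀ t : ℝ≥0, t * (open Classical in ∑' ξ : UnitaryDual G,
      if t ≤ u ξ then (ξ.rep.dim : ℝ≥0∞) ^ 2 else 0) ≤ 1)
    (hw : ∀ ξ, (symbolNorm μ A ξ.rep : ℝ≥0∞) ^ 2 ≤
      (M : ℝ≥0∞) ^ 2 * ((u ξ : ℝ≥0∞) ^ (2 / p - 1) * (u ξ : ℝ≥0∞) ^ (2 / (q / (q - 1)) - 1))) :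
    lpLqNorm μ A p q ≤ M * (paleyConst p + paleyConst (q / (q - 1))) := by
  have hp0 : 0 < p := by linarith
  have hq0 : 0 < q := by linarith
  have hq1 : 0 < q - 1 := by linarith
  have hq' : 1 < q / (q - 1) := by rw [lt_div_iff₀ hq1]; linarith
  have hq2 : q / (q - 1) ≤ 2 := by rw [div_le_iff₀ hq1]; linarith
  have heLp : ∀ {r : ℝ}, 0 < r → ∀ g : G → ℂ, eLpNorm g (ENNReal.ofReal r) μ =
      (∫⁻ x, ‖g x‖ₑ ^ r ∂μ) ^ (1 / r) := fun {r} hr g => by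
    rw [eLpNorm_eq_lintegral_rpow_enorm_toReal (by simpa using hr) ENNReal.ofReal_ne_top,
      ENNReal.toReal_ofReal hr.le]
  refine iSup₂_le fun f hf => ?_
  have hfp : ∫⁻ x, ‖((f : Lp ℂ 2 μ) : G → ℂ) x‖ₑ ^ p ∂μ ≤ 1 := by
    rw [heLp hp0] at hf
    have := ENNReal.rpow_le_rpow hf hp0.le
    rwa [← ENNReal.rpow_mul, one_div, inv_mul_cancel₀ hp0.ne', ENNReal.rpow_one,
      ENNReal.one_rpow] at this
  have hF := (isSquareMass_coeffMass μ).paley hp hp2 u hu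
    (Lp.stronglyMeasurable (f : Lp ℂ 2 μ)) (Lp.memLp _) hfp
  -- Test functions h have unit norm in L^{q/(q-1)} with 1 < q/(q-1) ≤ 2, so Paley's inequality
  -- applies to f and to h with the same weight u.
  have key := lintegral_rpow_le_of_dual (μ := μ) (Lp.stronglyMeasurable (A f)) hq
    (K := M * (paleyConst p + paleyConst (q / (q - 1)))) fun h hhm hh hh1 => by
      have hH := (isSquareMass_coeffMass μ).paley hq' hq2 u hu
        (Lp.stronglyMeasurable (hh.toLp h)) (Lp.memLp _) (by
          refine le_of_eq_of_le (lintegral_congr_ae ?_) hh1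
          filter_upwards [hh.coeFn_toLp] with x hx
          rw [hx])
      have h1 : inner ℂ (hh.toLp h) (A f) = ∫ x, A f x * (starRingEnd ℂ) (h x) ∂μ := by
        rw [L2.inner_def]
        refine integral_congr_ae ?_
        filter_upwards [hh.coeFn_toLp] with x hx
        rw [hx]
        rfl
      rw [← h1]
      refine (hA.enorm_inner_apply_le f (hh.toLp h) (by simpa using hM) ENNReal.coe_ne_top
        (fun ξ => ENNReal.rpow_ne_top_of_nonneg ?_ ENNReal.coe_ne_top) hw).trans ?_
      · rw [sub_nonneg, le_div_iff₀ (by positivity)]; linarith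
      · exact mul_le_mul_right (add_le_add hF hH) _
  rw [heLp hq0]
  refine (ENNReal.rpow_le_rpow key (by positivity)).trans_eq ?_
  rw [← ENNReal.rpow_mul, mul_one_div, div_self hq0.ne', ENNReal.rpow_one]

/-- The weak-type hypothesis on the symbol provides a weight of weak type `ℓ¹`. -/
lemma exists_weight {p q : ℝ} (hp : 1 < p) (hp2 : p ≤ 2) (hq : 2 ≤ q) {M : ℝ≥0} (hM : M ≠ 0)
    (h : ∀ s : ℝ≥0, (s : ℝ≥0∞) * powZ (levelSum μ A s) (1 / p - 1 / q) ≤ M) :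
    ∃ u : UnitaryDual G → ℝ≥0,
      (∀ t : ℝ≥0, t * (open Classical in ∑' ξ : UnitaryDual G,
        if t ≤ u ξ then (ξ.rep.dim : ℝ≥0∞) ^ 2 else 0) ≤ 1) ∧
      ∀ ξ, (symbolNorm μ A ξ.rep : ℝ≥0∞) ^ 2 ≤ (M : ℝ≥0∞) ^ 2 *
        ((u ξ : ℝ≥0∞) ^ (2 / p - 1) * (u ξ : ℝ≥0∞) ^ (2 / (q / (q - 1)) - 1)) := by
  have hp0 : 0 < p := by linarith
  have hq0 : 0 < q := by linarith
  have hq1 : 0 < q - 1 := by linarith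
  have h1 : 1 / 2 ≤ 1 / p := one_div_le_one_div_of_le hp0 hp2
  have h2 : 1 / q ≤ 1 / 2 := one_div_le_one_div_of_le two_pos hq
  have hβ1 : 0 ≤ 2 / p - 1 := by rw [sub_nonneg, le_div_iff₀ hp0]; linarith
  have hβ2 : 0 ≤ 2 / (q / (q - 1)) - 1 := by
    rw [sub_nonneg, le_div_iff₀ (by positivity), one_mul, div_le_iff₀ hq1]; linarith
  have hsum : (2 / p - 1) + (2 / (q / (q - 1)) - 1) = 2 * (1 / p - 1 / q) := by
    field_simp
    ring
  set δ := 1 / p - 1 / q with hδ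
  rcases (show 0 ≤ δ by linarith).eq_or_lt with h0 | hpos
  -- Here p = q = 2 and both exponents of u are 0. Since `0 ^ 0 = 1` for `ENNReal.rpow`, the zero
  -- weight works, and what remains is ‖σ_A(ξ)‖ ≤ M.
  · refine ⟨fun _ => 0, fun t => ?_, fun ξ => ?_⟩
    · rcases eq_or_ne t 0 with rfl | ht
      · simp
      · simp [ht]
    · have hb1 : 2 / p - 1 = 0 := by linarith
      have hb2 : 2 / (q / (q - 1)) - 1 = 0 := by linarith
      rw [hb1, hb2]
      simp only [ENNReal.rpow_zero, mul_one]
      refine pow_le_pow_left' ?_ 2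
      have hs := h (symbolNorm μ A ξ.rep)
      -- The level set at height ‖σ_A(ξ)‖ contains ξ, so the convention 0⁰ = 0 in `powZ` does not
      -- intervene.
      have hne : levelSum μ A (symbolNorm μ A ξ.rep) ≠ 0 := by
        rw [levelSum, Ne, ENNReal.tsum_eq_zero]
        intro h'
        have := h' ⟨ξ, le_rfl⟩
        simp [ξ.rep.dim_pos.ne'] at this
      rw [powZ, if_neg hne, ← h0, ENNReal.rpow_zero, mul_one] at hs
      exact hs
  -- The weight solves ‖σ_A‖ = M u^δ. Then {u ≥ t} is the level set at s = M t^δ, and the hypothesis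
  -- at s becomes (tN)^δ ≤ 1 for its total weight N.
  · refine ⟨fun ξ => (symbolNorm μ A ξ.rep / M) ^ (1 / δ), fun t => ?_, fun ξ => ?_⟩
    · rcases eq_or_ne t 0 with rfl | ht
      · simp
      have hiff : ∀ ξ : UnitaryDual G, t ≤ (symbolNorm μ A ξ.rep / M) ^ (1 / δ) ↔
          t ^ δ * M ≤ symbolNorm μ A ξ.rep := fun ξ => by
        rw [one_div, NNReal.le_rpow_inv_iff hpos, le_div_iff₀ (pos_iff_ne_zero.mpr hM)]
      simp_rw [hiff]
      rw [← levelSum_eq_tsum_ite]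
      set N := levelSum μ A (t ^ δ * M)
      by_cases hN : N = 0
      · rw [hN, mul_zero]; exact zero_le_one
      have hs := h (t ^ δ * M)
      rw [powZ, if_neg hN, ENNReal.coe_mul, ENNReal.coe_rpow_of_nonneg _ hpos.le,
        mul_right_comm, ← ENNReal.mul_rpow_of_nonneg _ _ hpos.le] at hs
      have hs' : ((t : ℝ≥0∞) * N) ^ δ ≤ 1 := by
        by_contra! hlt
        refine absurd hs (not_le.mpr ?_)
        calc (M : ℝ≥0∞) = 1 * M := (one_mul _).symm
          _ < _ := ENNReal.mul_lt_mul_left (by simpa using hM) ENNReal.coe_ne_top hlt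
      have := ENNReal.rpow_le_rpow hs' (inv_nonneg.mpr hpos.le)
      rwa [← ENNReal.rpow_mul, mul_inv_cancel₀ hpos.ne', ENNReal.rpow_one,
        ENNReal.one_rpow] at this
    · rw [← ENNReal.rpow_add_of_nonneg _ _ hβ1 hβ2, hsum, ← ENNReal.coe_rpow_of_nonneg _
        (by positivity), ← NNReal.rpow_mul]
      have : 1 / δ * (2 * δ) = 2 := by field_simp
      rw [this]
      norm_cast
      rw [← mul_pow, mul_div_cancel₀ _ hM]

end Main

end CompactMultiplier

theorem theorem3 (p q : ℝ) (hp : 1 < p) (hp2 : p ≤ 2) (hq : 2 ≤ q) :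
    ∃ C : ℝ≥0, ∀ (n : ℕ) (G : Type*) [Group G] [TopologicalSpace G] [IsTopologicalGroup G]
      [T2Space G] [CompactSpace G]
      [ChartedSpace (EuclideanSpace ℝ (Fin n)) G] [LieGroup (𝓡 n) ∞ G]
      [MeasurableSpace G] [BorelSpace G]
      (μ : Measure G) [μ.IsHaarMeasure] [IsProbabilityMeasure μ]
      (A : Lp ℂ 2 μ →ₗ.[ℂ] Lp ℂ 2 μ), CompactMultiplier.IsLeftFourierMultiplier μ A →
      CompactMultiplier.lpLqNorm μ A p q ≤
        C * ⨆ s : ℝ≥0, (s : ℝ≥0∞) *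
          CompactMultiplier.powZ (CompactMultiplier.levelSum μ A s) (1 / p - 1 / q) := by
  have hq1 : 0 < q - 1 := by linarith
  have hC : CompactMultiplier.paleyConst p + CompactMultiplier.paleyConst (q / (q - 1)) ≠ ⊤ :=
    ENNReal.add_ne_top.mpr ⟨CompactMultiplier.paleyConst_ne_top hp hp2,
      CompactMultiplier.paleyConst_ne_top (by rw [lt_div_iff₀ hq1]; linarith)
        (by rw [div_le_iff₀ hq1]; linarith)⟩
  -- The added 1 keeps the constant nonzero, so that it can be divided out below.
  refine ⟨(CompactMultiplier.paleyConst p + CompactMultiplier.paleyConst (q / (q - 1))).toNNReal + 1,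
    fun n G _ _ _ _ _ _ _ _ _ μ _ _ A hA => ?_⟩
  set S := ⨆ s : ℝ≥0, (s : ℝ≥0∞) *
    CompactMultiplier.powZ (CompactMultiplier.levelSum μ A s) (1 / p - 1 / q) with hS
  set C := (CompactMultiplier.paleyConst p + CompactMultiplier.paleyConst (q / (q - 1))).toNNReal
  -- Constructing the weight divides by M, so the bound is proved for all finite M > S, which are
  -- nonzero, and M decreases to S; this covers S = 0.
  have hle : ∀ M : ℝ≥0, S < M → CompactMultiplier.lpLqNorm μ A p q ≤ (C + 1 : ℝ≥0) * M := by
    intro M hM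
    have hM0 : M ≠ 0 := by
      rintro rfl
      simp at hM
    obtain ⟨u, hu, hw⟩ := CompactMultiplier.exists_weight (A := A) hp hp2 hq hM0 fun s =>
      (le_iSup (fun s : ℝ≥0 => (s : ℝ≥0∞) *
        CompactMultiplier.powZ (CompactMultiplier.levelSum μ A s) (1 / p - 1 / q)) s).trans hM.le
    refine (hA.lpLqNorm_le hp hp2 hq hM0 u hu hw).trans ?_
    rw [mul_comm, ← ENNReal.coe_toNNReal hC]
    exact mul_le_mul_left (by exact_mod_cast le_self_add) _
  rcases eq_or_ne S ⊤ with hT | hT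
  · rw [hT, ENNReal.mul_top (by simp)]
    exact le_top
  have hC0 : ((C + 1 : ℝ≥0) : ℝ≥0∞) ≠ 0 := by simp
  rw [mul_comm, ← ENNReal.div_le_iff_le_mul (Or.inl hC0) (Or.inl ENNReal.coe_ne_top)]
  refine le_of_forall_gt_imp_ge_of_dense fun M hM => ?_
  induction M with
  | top => exact le_top
  | coe M =>
    rw [ENNReal.div_le_iff_le_mul (Or.inl hC0) (Or.inl ENNReal.coe_ne_top), mul_comm]
    exact hle M hM

end
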